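/- Let $\lambda,\mu,P,T,T_{\rm FR}>0$, $\sigma^2\ge 0$, $\alpha>2$, $\beta\ge 1$, let $\Delta\ge 1$ be an integer, and put $\eta=(\Delta-1+\beta)/\Delta$. Base stations form a homogeneous Poisson point process of intensity $\lambda$ on $\mathbb R^2$; a user at the origin is served by its nearest base station $y$, at distance $r$, and $R_z$ denotes the distance of the base station $z$. On the initial sub-band and on the newly assigned one, the fading powers $g_z$ and $\hat g_z$ are all i.i.d. exponential with rate $\mu$ (mean $1/\mu$), independent of the base stations. Let $I_r=\sum_{z\ne y}g_zR_z^{-\alpha}$ and $\hat I_r=\sum_{z\ne y}\hat g_zR_z^{-\alpha}$. In the Soft Frequency Reuse model with power-control factor $\beta$ and effective interference factor $\eta$, the initial SINR of the user is $\frac{Pg_yr^{-\alpha}}{\sigma^2+\eta PI_r}$; the user is an edge user if this is less than $T_{\rm FR}$, and is then moved to a sub-band on which it has the SINR $\frac{\beta P\hat g_yr^{-\alpha}}{\sigma^2+\eta P\hat I_r}$. For a noise power $N\ge0$ let $$p_c(t,\lambda,\alpha,\delta;N)=\pi\lambda\int_0^\infty e^{-\pi\lambda v\left(1+\frac1\delta\rho(t,\alpha)\right)-\mu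 t\frac{N}{P}v^{\alpha/2}}\,dv,\qquad \rho(t,\alpha)=t^{2/\alpha}\int_{t^{-2/\alpha}}^\infty\frac{du}{1+u^{\alpha/2}}.$$ Then almost surely there is a nearest base station and both interference sums converge, the integrals defining $\xi$ and appearing in the numerator below converge, the user is an edge user with positive probability, and the coverage probability of an edge user is $$\mathbb P\left(\frac{\beta P\hat g_yr^{-\alpha}}{\sigma^2+\eta P\hat I_r}>T\ \Big|\ \frac{Pg_yr^{-\alpha}}{\sigma^2+\eta PI_r}<T_{\rm FR}\right)=\frac{p_c\!\left(\frac{\eta T}{\beta},\lambda,\alpha,1;\frac{\sigma^2}{\eta}\right)-\pi\lambda\int_0^\infty e^{-\pi\lambda v(1+2\xi)-\mu\left(\frac T\beta+T_{\rm FR}\right)\frac{\sigma^2}{P}v^{\alpha/2}}\,dv}{1-p_c\!\left(\eta T_{\rm FR},\lambda,\alpha,1;\frac{\sigma^2}{\eta}\right)},$$ where $$\xi=\int_1^\infty\left[1-\frac1{1+\eta T_{\rm FR}x^{-\alpha}}\cdot\frac1{1+\frac{\eta T}\beta x^{-\alpha}}\right]x\,dx.$$ -/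

import Mathlib

open MeasureTheory ProbabilityTheory Set

noncomputable section

/-- The plane `ℝ²` with its Euclidean norm and Lebesgue measure. The user sits at the origin. -/
abbrev Plane : Type := EuclideanSpace ℝ (Fin 2)

/-- The number of points of the configuration `x` that lie in `B`. -/
def pointCount (x : ℕ → Plane) (B : Set Plane) : ℕ∞ :=
  Set.encard {n | x n ∈ B}

/-- `X 0, X 1, …` enumerates, in some measurable way, the points of a homogeneous Poisson point
process of intensity `lam` on the plane: the number of points in a Borel set `B` of finite area
is Poisson distributed with mean `lam * area B`, and the numbers of points in finitely many
disjoint sets are independent. (As the plane has infinite area, such a process has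
infinitely many points almost surely, so that it can be enumerated by `ℕ`.) -/
structure IsHomogeneousPPP {Ω : Type*} [MeasurableSpace Ω] (Pr : Measure Ω) (lam : ℝ)
    (X : ℕ → Ω → Plane) : Prop where
  measurable : ∀ n, Measurable (X n)
  poisson : ∀ B : Set Plane, MeasurableSet B → volume B ≠ ⊤ → ∀ k : ℕ,
    Pr {ω | pointCount (fun n => X n ω) B = (k : ℕ∞)} =
      poissonMeasure (Real.toNNReal (lam * (volume B).toReal)) {k}
  indep : ∀ (m : ℕ) (B : Fin m → Set Plane), (∀ i, MeasurableSet (B i)) →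
    (∀ i, volume (B i) ≠ ⊤) → Pairwise (fun i j => Disjoint (B i) (B j)) →
    iIndepFun (fun (i : Fin m) (ω : Ω) => pointCount (fun n => X n ω) (B i)) Pr

/-- The base station `x n` is a nearest one to the user. -/
def IsNearest (x : ℕ → Plane) (n : ℕ) : Prop := ∀ m, ‖x n‖ ≤ ‖x m‖

/-- The index of the serving base station, i.e. of the base station nearest to the user (the
smallest index in case of a tie, which has probability zero). -/
def servingBS (x : ℕ → Plane) : ℕ := sInf {n | IsNearest x n}

/-- The contribution `g_z R_z^{-α}` of the base station `n` to the out-of-cell interference;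
the serving base station contributes nothing. -/
def interferenceTerm (α : ℝ) (x : ℕ → Plane) (g : ℕ → ℝ) (n : ℕ) : ℝ :=
  if n = servingBS x then 0 else g n * ‖x n‖ ^ (-α)

/-- The out-of-cell interference `I_r = ∑_z g_z R_z^{-α}` over all base stations `z` other than
the serving one. -/
def interference (α : ℝ) (x : ℕ → Plane) (g : ℕ → ℝ) : ℝ :=
  ∑' n, interferenceTerm α x g n

/-- The effective interference power factor `η = (Δ - 1 + β) / Δ`. -/
def etaSFR (Δ : ℕ) (β : ℝ) : ℝ := ((Δ : ℝ) - 1 + β) / (Δ : ℝ)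

/-- The ratio `P₀ g_y r^{-α} / (N + P₁ I_r)`, where the serving base station, at distance `r`,
transmits with power `P₀`, the noise power is `N`, and the interfering base stations transmit
with (effective) power `P₁`. -/
def sinr (α N P₀ P₁ : ℝ) (x : ℕ → Plane) (g : ℕ → ℝ) : ℝ :=
  P₀ * g (servingBS x) * ‖x (servingBS x)‖ ^ (-α) / (N + P₁ * interference α x g)

/-- `ρ(T, α) = T^{2/α} ∫_{T^{-2/α}}^∞ du / (1 + u^{α/2})`. -/
def rho (T α : ℝ) : ℝ :=
  T ^ (2 / α) * ∫ u in Ioi (T ^ (-(2 / α))), 1 / (1 + u ^ (α / 2))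

/-- `p_c(T, λ, α, Δ) = πλ ∫_0^∞ exp(-πλv(1 + ρ(T, α)/Δ) - μ T (N/P) v^{α/2}) dv`, with the
fading rate `μ`, the noise power `N` and the transmit power `P` as explicit arguments. -/
def pc (μ N P T lam α Δ : ℝ) : ℝ :=
  Real.pi * lam * ∫ v in Ioi (0 : ℝ),
    Real.exp (-(Real.pi * lam * v * (1 + 1 / Δ * rho T α)) - μ * T * (N / P) * v ^ (α / 2))

/-- The integrand of `ξ`. -/
def xiIntegrand (T TFR α η β x : ℝ) : ℝ :=
  (1 - 1 / (1 + η * TFR * x ^ (-α)) * (1 / (1 + η * T / β * x ^ (-α)))) * x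

/-- `ξ = ∫_1^∞ [1 - 1/(1 + η T_FR x^{-α}) · 1/(1 + (ηT/β) x^{-α})] x dx`. -/
def xiSFR (T TFR α η β : ℝ) : ℝ :=
  ∫ x in Ioi (1 : ℝ), xiIntegrand T TFR α η β x

/-- The integrand `exp(-πλv(1 + 2ξ) - μ (T/β + T_FR) (N/P) v^{α/2})`. -/
def jointIntegrand (μ N P T TFR lam α η β v : ℝ) : ℝ :=
  Real.exp (-(Real.pi * lam * v * (1 + 2 * xiSFR T TFR α η β))
    - μ * (T / β + TFR) * (N / P) * v ^ (α / 2))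

end

/-! ### The extended exponential and point counts -/

open Filter
open scoped ENNReal Topology

/-! Fix the base stations and write r for the distance of the serving one. The event SINR ≥ t says
that g_y exceeds a noise term plus a weighted sum of the other fading powers. The exponential tail
of g_y turns this into a product of Laplace transforms of exponential variables, so the conditional
probability is exp(-k r^α - ∑_{z≠y} log(1 + a (R_z/r)^{-α})), with a the threshold times the ratio
of interfering to serving power (`IsRegularConfig.measure_sinr`). On the two sub-bands the fading is
independent given the stations, so the joint probability is the product and the exponents add. The
expectation is always that of exp(-k r^α - ∑_{z≠y} F(R_z/r)) for a radial loss F, and the sum of two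
losses is again such an F. This is why ξ, and not a product of two ρ's, appears in the joint term.

To average over the stations, the Laplace functional is derived from the Poisson counts
(`IsHomogeneousPPP.laplace`). Conditioning on r is done by hand. Round r up to a grid. The event
that r lies in a cell is a difference of two void events, and giving a ball infinite weight in the
Laplace functional shows that such an event factors from any function supported outside the larger
ball (`IsHomogeneousPPP.setLIntegral_shell`). Refining the grid gives
`IsHomogeneousPPP.lintegral_exp_pathLoss`: the sum contributes exp(-2πλ r² ∫_1^∞ (1 - e^{-F(u)}) u
du). Since r² is exponential with rate πλ, an integral over v = r² remains
(`IsHomogeneousPPP.lintegral_coverage`).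

With A the event that the user is not an edge user and B that the new SINR exceeds T, the claim is
P(B | Aᶜ) = (P(B) - P(A ∩ B)) / (1 - P(A)). The denominator is positive because the conditional
exponent is almost surely positive. -/

/-- `exp (-z)` for an extended nonnegative real `z`, with `exp (-∞) = 0`. -/
noncomputable def expNeg (z : ℝ≥0∞) : ℝ≥0∞ := EReal.exp (-(z : EReal))

lemma expNeg_zero : expNeg 0 = 1 := by simp [expNeg]

lemma expNeg_top : expNeg ⊤ = 0 := by simp [expNeg]

lemma expNeg_ofReal {x : ℝ} (hx : 0 ≤ x) :
    expNeg (ENNReal.ofReal x) = ENNReal.ofReal (Real.exp (-x)) := by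
  rw [expNeg, EReal.coe_ennreal_ofReal, max_eq_left hx, ← EReal.coe_neg, EReal.exp_coe]

lemma expNeg_add (x y : ℝ≥0∞) : expNeg (x + y) = expNeg x * expNeg y := by
  simp only [expNeg, EReal.coe_ennreal_add]
  rw [EReal.neg_add (Or.inl (by simp)) (Or.inr (by simp)), sub_eq_add_neg, EReal.exp_add]

lemma continuous_expNeg : Continuous expNeg := by
  unfold expNeg
  have h1 : Continuous EReal.exp := ENNReal.continuous_exp
  exact h1.comp (continuous_neg.comp continuous_coe_ennreal_ereal)

lemma expNeg_antitone : Antitone expNeg := fun x y h => by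
  unfold expNeg
  exact EReal.exp_monotone (EReal.neg_le_neg_iff.2 (by exact_mod_cast h))

lemma expNeg_le_one (x : ℝ≥0∞) : expNeg x ≤ 1 := expNeg_zero ▸ expNeg_antitone (bot_le)

lemma expNeg_ne_top (x : ℝ≥0∞) : expNeg x ≠ ⊤ := ((expNeg_le_one x).trans_lt ENNReal.one_lt_top).ne

lemma expNeg_sum {ι : Type*} (s : Finset ι) (f : ι → ℝ≥0∞) :
    expNeg (∑ i ∈ s, f i) = ∏ i ∈ s, expNeg (f i) := by
  classical
  induction s using Finset.induction_on with
  | empty => simp [expNeg_zero]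
  | insert a s ha ih => rw [Finset.sum_insert ha, Finset.prod_insert ha, expNeg_add, ih]

lemma expNeg_mul_nat (y : ℝ≥0∞) (k : ℕ) : expNeg (y * k) = expNeg y ^ k := by
  have := expNeg_sum (Finset.range k) (fun _ => y)
  simpa [mul_comm] using this

lemma measurable_expNeg : Measurable expNeg := continuous_expNeg.measurable

lemma pointCount_eq_tsum (x : ℕ → Plane) (B : Set Plane) :
    ((pointCount x B : ℕ∞) : ℝ≥0∞) = ∑' n, B.indicator (fun _ => (1 : ℝ≥0∞)) (x n) := by
  have h : ∀ n, B.indicator (fun _ => (1 : ℝ≥0∞)) (x n) = {n | x n ∈ B}.indicator 1 n := by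
    intro n; simp [indicator]
  simp_rw [h]
  rw [← tsum_subtype, pointCount]
  exact (ENNReal.tsum_set_one _).symm

/-! ### Generating function of a Poisson count -/

section Poisson

variable {Ω : Type*} [MeasurableSpace Ω] {Pr : Measure Ω} {lam : ℝ} {X : ℕ → Ω → Plane}

lemma IsHomogeneousPPP.measurable_pointCount (hX : IsHomogeneousPPP Pr lam X) {B : Set Plane}
    (hB : MeasurableSet B) : Measurable fun ω => pointCount (fun n => X n ω) B := by
  unfold pointCount
  refine measurable_encard.comp ?_
  refine measurable_set_iff.2 fun n => ?_
  exact measurable_to_prop (by simpa [preimage] using hX.measurable n hB)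

lemma IsHomogeneousPPP.lintegral_pointCount [IsProbabilityMeasure Pr]
    (hX : IsHomogeneousPPP Pr lam X) {B : Set Plane} (hB : MeasurableSet B)
    (hB' : volume B ≠ ⊤) (h : ℕ∞ → ℝ≥0∞) :
    ∫⁻ ω, h (pointCount (fun n => X n ω) B) ∂Pr =
      ∑' k : ℕ, h k * poissonMeasure (Real.toNNReal (lam * (volume B).toReal)) {k} := by
  have hm := hX.measurable_pointCount hB
  set m := Real.toNNReal (lam * (volume B).toReal)
  have hk : ∀ k : ℕ, Pr.map (fun ω => pointCount (fun n => X n ω) B) {(k : ℕ∞)} =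
      poissonMeasure m {k} := fun k => by
    rw [Measure.map_apply hm (measurableSet_singleton _)]
    exact hX.poisson B hB hB' k
  have : IsProbabilityMeasure (Pr.map (fun ω => pointCount (fun n => X n ω) B)) :=
    Measure.isProbabilityMeasure_map hm.aemeasurable
  -- Only finite counts are prescribed. Their Poisson weights already sum to one, which leaves no
  -- mass for ⊤.
  have htop : Pr.map (fun ω => pointCount (fun n => X n ω) B) {⊤} = 0 := by
    have h1 : ({⊤} : Set ℕ∞) = (range ((↑) : ℕ → ℕ∞))ᶜ := by
      ext x; induction x <;> simp
    have h2 : Pr.map (fun ω => pointCount (fun n => X n ω) B) (range ((↑) : ℕ → ℕ∞)) = 1 := by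
      rw [← iUnion_singleton_eq_range, measure_iUnion _ (fun _ => measurableSet_singleton _)]
      · simp_rw [hk]
        rw [← measure_iUnion (fun i j hij => by simpa using hij)
          (fun _ => measurableSet_singleton _), iUnion_of_singleton, measure_univ]
      · intro i j hij
        simpa using hij
    rw [h1, measure_compl (MeasurableSet.of_discrete) (measure_ne_top _ _), h2, measure_univ]
    simp
  rw [← lintegral_map (μ := Pr) (f := h) Measurable.of_discrete hm, lintegral_countable']
  rw [← Function.Injective.tsum_eq (g := ((↑) : ℕ → ℕ∞)) Nat.cast_injective]
  · simp_rw [hk]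
  · intro x hx
    induction x using ENat.recTopCoe with
    | top => simp [htop] at hx
    | coe k => exact ⟨k, rfl⟩

/-- The generating function ∑ q^k e^{-m} m^k / k! = e^{-m(1-q)} of the Poisson law, at q = e^{-y}.
The value y = ⊤ is allowed and gives void probabilities. -/
lemma IsHomogeneousPPP.lintegral_expNeg_mul_pointCount [IsProbabilityMeasure Pr]
    (hlam : 0 ≤ lam) (hX : IsHomogeneousPPP Pr lam X) {B : Set Plane} (hB : MeasurableSet B)
    (hB' : volume B ≠ ⊤) (y : ℝ≥0∞) :
    ∫⁻ ω, expNeg (y * (pointCount (fun n => X n ω) B : ℕ∞)) ∂Pr =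
      expNeg (ENNReal.ofReal lam * ((1 - expNeg y) * volume B)) := by
  rw [hX.lintegral_pointCount hB hB' (fun k => expNeg (y * (k : ℝ≥0∞)))]
  obtain ⟨q, hq0, hq⟩ : ∃ q : ℝ, 0 ≤ q ∧ expNeg y = ENNReal.ofReal q :=
    ⟨(expNeg y).toReal, ENNReal.toReal_nonneg, (ENNReal.ofReal_toReal (expNeg_ne_top y)).symm⟩
  have hq1 : q ≤ 1 := by
    have := expNeg_le_one y
    rwa [hq, ENNReal.ofReal_le_one] at this
  set m : ℝ := lam * (volume B).toReal with hm
  have hm0 : 0 ≤ m := by positivity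
  have hterm : ∀ k : ℕ, expNeg (y * ((k : ℕ∞) : ℝ≥0∞)) * poissonMeasure (Real.toNNReal m) {k} =
      ENNReal.ofReal (Real.exp (-m) * ((m * q) ^ k / (k.factorial : ℝ))) := by
    intro k
    rw [ENat.toENNReal_coe, expNeg_mul_nat, hq, poissonMeasure_singleton, ← ENNReal.ofReal_pow hq0,
      ← ENNReal.ofReal_mul (by positivity), Real.coe_toNNReal _ hm0]
    congr 1
    rw [mul_pow]; ring
  simp_rw [hterm]
  have hs : HasSum (fun k : ℕ => Real.exp (-m) * ((m * q) ^ k / (k.factorial : ℝ)))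
      (Real.exp (-m) * Real.exp (m * q)) := by
    refine HasSum.mul_left _ ?_
    rw [Real.exp_eq_exp_ℝ]
    exact NormedSpace.expSeries_div_hasSum_exp (m * q)
  rw [← ENNReal.ofReal_tsum_of_nonneg (fun k => by positivity) hs.summable, hs.tsum_eq]
  have h1 : (1 : ℝ≥0∞) - expNeg y = ENNReal.ofReal (1 - q) := by
    rw [hq, ENNReal.ofReal_sub _ hq0, ENNReal.ofReal_one]
  have hv : 0 ≤ (1 - q) * (volume B).toReal :=
    mul_nonneg (by linarith) ENNReal.toReal_nonneg
  rw [h1, ← ENNReal.ofReal_toReal hB', ← ENNReal.ofReal_mul (by linarith),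
    ← ENNReal.ofReal_mul hlam, expNeg_ofReal (mul_nonneg hlam hv), ← Real.exp_add]
  congr 2
  rw [hm]; ring

end Poisson

/-! ### The Laplace functional -/

section Laplace

variable {Ω : Type*} [MeasurableSpace Ω] {Pr : Measure Ω} [IsProbabilityMeasure Pr] {lam : ℝ}
  {X : ℕ → Ω → Plane}

/-- The sum over points is a combination of counts in the level sets, which are disjoint and hence
have independent counts. Cutting to a ball gives these sets finite area. -/
lemma IsHomogeneousPPP.laplace_simpleFunc (hlam : 0 ≤ lam) (hX : IsHomogeneousPPP Pr lam X)
    (ρ : SimpleFunc Plane ℝ≥0∞) (R : ℝ) :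
    ∫⁻ ω, expNeg (∑' n, (Metric.ball (0 : Plane) R).indicator ρ (X n ω)) ∂Pr =
      expNeg (ENNReal.ofReal lam * ∫⁻ x in Metric.ball (0 : Plane) R, (1 - expNeg (ρ x))) := by
  set e := ρ.range.equivFin
  set B : Fin ρ.range.card → Set Plane :=
    fun i => ρ ⁻¹' {(e.symm i : ℝ≥0∞)} ∩ Metric.ball 0 R with hBdef
  have hBm : ∀ i, MeasurableSet (B i) := fun i =>
    (ρ.measurableSet_preimage _).inter Metric.isOpen_ball.measurableSet
  have hBf : ∀ i, volume (B i) ≠ ⊤ := fun i =>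
    ((measure_mono inter_subset_right).trans_lt measure_ball_lt_top).ne
  have hBd : Pairwise fun i j => Disjoint (B i) (B j) := by
    intro i j hij
    refine Set.disjoint_left.2 fun x hx hx' => hij ?_
    have h1 : ρ x = e.symm i := hx.1
    have h2 : ρ x = e.symm j := hx'.1
    exact e.symm.injective (Subtype.ext (h1.symm.trans h2))
  have hpt : ∀ x, (Metric.ball (0 : Plane) R).indicator ρ x =
      ∑ i, (e.symm i : ℝ≥0∞) * (B i).indicator (fun _ => (1 : ℝ≥0∞)) x := by
    intro x
    by_cases hx : x ∈ Metric.ball (0 : Plane) R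
    · rw [indicator_of_mem hx, Finset.sum_eq_single (e ⟨ρ x, ρ.mem_range_self x⟩)]
      · rw [indicator_of_mem]
        · simp
        · exact ⟨by simp, hx⟩
      · intro i _ hi
        rw [indicator_of_notMem, mul_zero]
        rintro ⟨h1, -⟩
        apply hi
        rw [← e.symm_apply_eq]
        exact Subtype.ext h1.symm
      · simp
    · rw [indicator_of_notMem hx, Finset.sum_eq_zero]
      intro i _
      rw [indicator_of_notMem (fun h => hx h.2), mul_zero]
  have hsum : ∀ ω, ∑' n, (Metric.ball (0 : Plane) R).indicator ρ (X n ω) =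
      ∑ i, (e.symm i : ℝ≥0∞) * (pointCount (fun n => X n ω) (B i) : ℕ∞) := by
    intro ω
    simp_rw [hpt, pointCount_eq_tsum, ← ENNReal.tsum_mul_left]
    exact Summable.tsum_finsetSum (fun _ _ => ENNReal.summable)
  simp_rw [hsum, expNeg_sum]
  have hind : iIndepFun (fun (i : Fin ρ.range.card) ω =>
      expNeg ((e.symm i : ℝ≥0∞) * (pointCount (fun n => X n ω) (B i) : ℕ∞))) Pr :=
    (hX.indep _ B hBm hBf hBd).comp (fun i (k : ℕ∞) => expNeg ((e.symm i : ℝ≥0∞) * (k : ℝ≥0∞)))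
      (fun _ => Measurable.of_discrete)
  rw [lintegral_prod_eq_prod_lintegral_of_indepFun _ _ hind fun i =>
    (Measurable.of_discrete (f := fun (k : ℕ∞) => expNeg ((e.symm i : ℝ≥0∞) * (k : ℝ≥0∞)))).comp
      (hX.measurable_pointCount (hBm i))]
  simp_rw [hX.lintegral_expNeg_mul_pointCount hlam (hBm _) (hBf _)]
  rw [← expNeg_sum, ← Finset.mul_sum]
  congr 2
  have h1 := SimpleFunc.map_lintegral (μ := volume.restrict (Metric.ball (0 : Plane) R))
    (fun y => 1 - expNeg y) ρ
  rw [← SimpleFunc.lintegral_eq_lintegral] at h1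
  simp only [SimpleFunc.coe_map, Function.comp_apply] at h1
  rw [h1, ← Finset.sum_coe_sort ρ.range, ← e.symm.sum_comp]
  refine Finset.sum_congr rfl fun i _ => ?_
  rw [Measure.restrict_apply (ρ.measurableSet_preimage _)]

/-- The **Laplace functional** of the Poisson point process. -/
theorem IsHomogeneousPPP.laplace (hlam : 0 ≤ lam) (hX : IsHomogeneousPPP Pr lam X)
    {f : Plane → ℝ≥0∞} (hf : Measurable f) :
    ∫⁻ ω, expNeg (∑' n, f (X n ω)) ∂Pr =
      expNeg (ENNReal.ofReal lam * ∫⁻ x, (1 - expNeg (f x))) := by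
  set F : ℕ → Plane → ℝ≥0∞ := fun m =>
    (Metric.ball (0 : Plane) m).indicator (SimpleFunc.eapprox f m) with hF
  have hFm : ∀ m, Measurable (F m) := fun m =>
    (SimpleFunc.measurable _).indicator Metric.isOpen_ball.measurableSet
  have hmono : ∀ x, Monotone fun m => F m x := by
    intro x m n hmn
    simp only [hF]
    by_cases hx : x ∈ Metric.ball (0 : Plane) m
    · rw [indicator_of_mem hx, indicator_of_mem (Metric.ball_subset_ball (by exact_mod_cast hmn) hx)]
      exact SimpleFunc.monotone_eapprox f hmn x
    · rw [indicator_of_notMem hx]; exact bot_le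
  have hlim : ∀ x, Tendsto (fun m => F m x) atTop (𝓝 (f x)) := by
    intro x
    have h1 : Tendsto (fun m => SimpleFunc.eapprox f m x) atTop (𝓝 (f x)) :=
      SimpleFunc.tendsto_eapprox hf x
    refine h1.congr' ?_
    obtain ⟨N, hN⟩ := exists_nat_gt ‖x‖
    filter_upwards [eventually_ge_atTop N] with m hm
    have hx : x ∈ Metric.ball (0 : Plane) m := by
      rw [mem_ball_zero_iff]
      exact hN.trans_le (by exact_mod_cast hm)
    simp only [hF]
    rw [indicator_of_mem hx]
  -- Monotone convergence for the counting measure on the indices.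
  have hsum : ∀ ω, Tendsto (fun m => ∑' n, F m (X n ω)) atTop (𝓝 (∑' n, f (X n ω))) := by
    intro ω
    simp_rw [← lintegral_count]
    exact lintegral_tendsto_of_tendsto_of_monotone (fun _ => Measurable.of_discrete.aemeasurable)
      (Eventually.of_forall fun n => hmono _) (Eventually.of_forall fun n => hlim _)
  have hL : Tendsto (fun m => ∫⁻ ω, expNeg (∑' n, F m (X n ω)) ∂Pr) atTop
      (𝓝 (∫⁻ ω, expNeg (∑' n, f (X n ω)) ∂Pr)) := by
    refine tendsto_lintegral_of_dominated_convergence (fun _ => 1) (fun m => ?_) (fun m => ?_)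
      (by simp) (Eventually.of_forall fun ω => (continuous_expNeg.tendsto _).comp (hsum ω))
    · exact measurable_expNeg.comp (Measurable.tsum fun n => (hFm m).comp (hX.measurable n))
    · exact Eventually.of_forall fun ω => expNeg_le_one _
  have hR : Tendsto (fun m => expNeg (ENNReal.ofReal lam * ∫⁻ x, (1 - expNeg (F m x)))) atTop
      (𝓝 (expNeg (ENNReal.ofReal lam * ∫⁻ x, (1 - expNeg (f x))))) := by
    refine (continuous_expNeg.tendsto _).comp
      (ENNReal.Tendsto.const_mul ?_ (Or.inr ENNReal.ofReal_ne_top))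
    refine lintegral_tendsto_of_tendsto_of_monotone
      (fun m => (measurable_const.sub (measurable_expNeg.comp (hFm m))).aemeasurable)
      (Eventually.of_forall fun x m n hmn => tsub_le_tsub_left (expNeg_antitone (hmono x hmn)) _)
      (Eventually.of_forall fun x => ?_)
    exact ENNReal.Tendsto.sub tendsto_const_nhds ((continuous_expNeg.tendsto _).comp (hlim x))
      (Or.inl ENNReal.one_ne_top)
  refine tendsto_nhds_unique hL (hR.congr fun m => ?_)
  rw [hX.laplace_simpleFunc hlam]
  congr 2
  rw [← lintegral_indicator Metric.isOpen_ball.measurableSet]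
  refine lintegral_congr fun x => ?_
  by_cases hx : x ∈ Metric.ball (0 : Plane) m
  · simp only [hF, indicator_of_mem hx]
  · simp only [hF, indicator_of_notMem hx, expNeg_zero, tsub_self]

end Laplace

/-! ### Almost sure properties of the process -/

lemma one_sub_expNeg_le (z : ℝ≥0∞) : 1 - expNeg z ≤ z := by
  induction z using ENNReal.recTopCoe with
  | top => exact le_top
  | coe x =>
    rw [← ENNReal.ofReal_coe_nnreal, expNeg_ofReal (NNReal.coe_nonneg x), ← ENNReal.ofReal_one,
      ← ENNReal.ofReal_sub _ (Real.exp_pos _).le]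
    refine ENNReal.ofReal_le_ofReal ?_
    have := Real.add_one_le_exp (-(x : ℝ))
    linarith

lemma volume_plane_ball {t : ℝ} (ht : 0 ≤ t) :
    volume (Metric.ball (0 : Plane) t) = ENNReal.ofReal (Real.pi * t ^ 2) := by
  rw [EuclideanSpace.volume_ball_fin_two, ← ENNReal.ofReal_pow ht,
    ← ENNReal.ofReal_mul (by positivity), mul_comm]

section PPP

variable {Ω : Type*} [MeasurableSpace Ω] {Pr : Measure Ω} [IsProbabilityMeasure Pr] {lam : ℝ}
  {X : ℕ → Ω → Plane}

/-- With S the sum, E[exp(-S/m)] is at most P(S < ∞), and by the Laplace functional it is at least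
exp(-(λ/m) ∫ f), which tends to 1. -/
lemma IsHomogeneousPPP.ae_tsum_ne_top (hlam : 0 ≤ lam) (hX : IsHomogeneousPPP Pr lam X)
    {f : Plane → ℝ≥0∞} (hf : Measurable f) (hfi : ∫⁻ x, f x ≠ ⊤) :
    ∀ᵐ ω ∂Pr, ∑' n, f (X n ω) ≠ ⊤ := by
  have hSm : Measurable fun ω => ∑' n, f (X n ω) :=
    Measurable.tsum fun n => hf.comp (hX.measurable n)
  set A : Set Ω := {ω | ∑' n, f (X n ω) ≠ ⊤} with hA
  have hAm : MeasurableSet A := (hSm (measurableSet_singleton ⊤)).compl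
  have hlow : ∀ m : ℕ, expNeg (ENNReal.ofReal lam * ((m : ℝ≥0∞)⁻¹ * ∫⁻ x, f x)) ≤ Pr A := by
    intro m
    calc expNeg (ENNReal.ofReal lam * ((m : ℝ≥0∞)⁻¹ * ∫⁻ x, f x))
        ≤ expNeg (ENNReal.ofReal lam * ∫⁻ x, (1 - expNeg ((m : ℝ≥0∞)⁻¹ * f x))) := by
          apply expNeg_antitone
          gcongr
          rw [← lintegral_const_mul _ hf]
          exact lintegral_mono fun x => one_sub_expNeg_le _
      _ = ∫⁻ ω, expNeg (∑' n, (m : ℝ≥0∞)⁻¹ * f (X n ω)) ∂Pr :=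
          (hX.laplace hlam (hf.const_mul _)).symm
      _ ≤ ∫⁻ ω, A.indicator 1 ω ∂Pr := by
          refine lintegral_mono fun ω => ?_
          by_cases hω : ω ∈ A
          · rw [indicator_of_mem hω]; exact expNeg_le_one _
          · have h1 : ∑' n, f (X n ω) = ⊤ := by simpa [hA] using hω
            simp only [ENNReal.tsum_mul_left, h1]
            -- This includes m = 0, whose inverse is ⊤.
            rw [ENNReal.mul_top (ENNReal.inv_ne_zero.2 (ENNReal.natCast_ne_top m)), expNeg_top]
            exact bot_le
      _ = Pr A := by rw [lintegral_indicator_one hAm]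
  have hlim : Tendsto (fun m : ℕ => expNeg (ENNReal.ofReal lam * ((m : ℝ≥0∞)⁻¹ * ∫⁻ x, f x)))
      atTop (𝓝 1) := by
    have h0 : Tendsto (fun m : ℕ => ENNReal.ofReal lam * ((m : ℝ≥0∞)⁻¹ * ∫⁻ x, f x)) atTop
        (𝓝 (ENNReal.ofReal lam * (0 * ∫⁻ x, f x))) :=
      ENNReal.Tendsto.const_mul
        (ENNReal.Tendsto.mul_const ENNReal.tendsto_inv_nat_nhds_zero (Or.inr hfi))
        (Or.inr ENNReal.ofReal_ne_top)
    have h1 := (continuous_expNeg.tendsto _).comp h0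
    rw [zero_mul, mul_zero, expNeg_zero] at h1
    exact h1
  have h1 : Pr A = 1 := le_antisymm prob_le_one (le_of_tendsto' hlim hlow)
  exact (prob_compl_eq_zero_iff hAm).2 h1

/-- Infinite weight on the null set {0} has integral zero, yet a single point there makes the sum
infinite. -/
lemma IsHomogeneousPPP.ae_ne_zero (hlam : 0 ≤ lam) (hX : IsHomogeneousPPP Pr lam X) :
    ∀ᵐ ω ∂Pr, ∀ n, X n ω ≠ 0 := by
  have h := hX.ae_tsum_ne_top hlam
    (f := ({0} : Set Plane).indicator fun _ => ⊤)
    (measurable_const.indicator (measurableSet_singleton _))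
    (by rw [lintegral_indicator (measurableSet_singleton _)]; simp)
  filter_upwards [h] with ω hω n hn
  exact hω (ENNReal.tsum_eq_top_of_eq_top ⟨n, by simp [hn]⟩)

/-- The shift by 1 removes the singularity at the origin, so that α > 2, the dimension, suffices for
integrability over the whole plane. -/
lemma IsHomogeneousPPP.ae_summable (hlam : 0 ≤ lam) (hX : IsHomogeneousPPP Pr lam X) {α : ℝ}
    (hα : 2 < α) : ∀ᵐ ω ∂Pr, Summable fun n => (1 + ‖X n ω‖) ^ (-α) := by
  have hi : Integrable (fun x : Plane => (1 + ‖x‖) ^ (-α)) :=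
    integrable_one_add_norm (by simpa using hα)
  have h := hX.ae_tsum_ne_top hlam (f := fun x => ENNReal.ofReal ((1 + ‖x‖) ^ (-α)))
    (by fun_prop) hi.lintegral_lt_top.ne
  filter_upwards [h] with ω hω
  have := ENNReal.summable_toReal hω
  refine this.congr fun n => ?_
  rw [ENNReal.toReal_ofReal (by positivity)]

/-- The Poisson law gives 1 - e^{-a}(1 + a), and e^{-a} ≥ 1 - a bounds it by a². -/
lemma IsHomogeneousPPP.measure_two_le (hlam : 0 ≤ lam) (hX : IsHomogeneousPPP Pr lam X)
    {B : Set Plane} (hB : MeasurableSet B) (hB' : volume B ≠ ⊤) :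
    Pr {ω | 2 ≤ pointCount (fun n => X n ω) B} ≤
      ENNReal.ofReal ((lam * (volume B).toReal) ^ 2) := by
  set a := lam * (volume B).toReal with ha
  have ha0 : 0 ≤ a := by positivity
  have hm := hX.measurable_pointCount hB
  have h0 := hX.poisson B hB hB' 0
  have h1 := hX.poisson B hB hB' 1
  rw [poissonMeasure_singleton, Real.coe_toNNReal _ ha0] at h0 h1
  set E0 := {ω | pointCount (fun n => X n ω) B = ((0 : ℕ) : ℕ∞)}
  set E1 := {ω | pointCount (fun n => X n ω) B = ((1 : ℕ) : ℕ∞)}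
  have hE0 : MeasurableSet E0 := hm (measurableSet_singleton _)
  have hE1 : MeasurableSet E1 := hm (measurableSet_singleton _)
  have hd : Disjoint E0 E1 := by
    refine Set.disjoint_left.2 fun ω h h' => ?_
    have h2 : ((0 : ℕ) : ℕ∞) = ((1 : ℕ) : ℕ∞) := h.symm.trans h'
    simp at h2
  have hU : Pr (E0 ∪ E1) = ENNReal.ofReal (Real.exp (-a) * (1 + a)) := by
    rw [measure_union hd hE1, h0, h1, ← ENNReal.ofReal_add (by positivity) (by positivity)]
    congr 1
    simp; ring
  have hsub : {ω | 2 ≤ pointCount (fun n => X n ω) B} ⊆ (E0 ∪ E1)ᶜ := by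
    intro ω hω h
    rcases h with h | h <;>
    · have h1 : pointCount (fun n => X n ω) B = _ := h
      have h2 : 2 ≤ pointCount (fun n => X n ω) B := hω
      rw [h1] at h2
      exact absurd h2 (by norm_num)
  refine (measure_mono hsub).trans ?_
  rw [measure_compl (hE0.union hE1) (measure_ne_top _ _), measure_univ, hU, ← ENNReal.ofReal_one,
    ← ENNReal.ofReal_sub _ (by positivity)]
  refine ENNReal.ofReal_le_ofReal ?_
  have := Real.add_one_le_exp (-a)
  nlinarith

lemma two_le_pointCount {x : ℕ → Plane} {B : Set Plane} {i j : ℕ} (hij : i ≠ j) (hi : x i ∈ B)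
    (hj : x j ∈ B) : 2 ≤ pointCount x B := by
  rw [pointCount, ← Set.encard_pair hij]
  refine Set.encard_le_encard ?_
  rintro n (rfl | rfl)
  exacts [hi, hj]

lemma volume_shell {s t : ℝ} (hs : 0 ≤ s) (hst : s ≤ t) :
    volume (Metric.ball (0 : Plane) t \ Metric.ball 0 s) =
      ENNReal.ofReal (Real.pi * (t ^ 2 - s ^ 2)) := by
  rw [measure_sdiff (Metric.ball_subset_ball hst) Metric.isOpen_ball.measurableSet.nullMeasurableSet
    measure_ball_lt_top.ne, volume_plane_ball hs, volume_plane_ball (hs.trans hst),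
    ← ENNReal.ofReal_sub _ (by positivity)]
  congr 1; ring

/-- Two points at equal distance below M lie in one of the M·m shells of width 1/m. Each shell has
area at most 2πM/m, so it contains two points with probability O(1/m²), and the union bound gives
O(1/m). -/
lemma IsHomogeneousPPP.measure_tie_le (hlam : 0 ≤ lam) (hX : IsHomogeneousPPP Pr lam X)
    (M m : ℕ) (hm : 0 < m) :
    Pr {ω | ∃ i j, i ≠ j ∧ ‖X i ω‖ = ‖X j ω‖ ∧ ‖X i ω‖ < M} ≤
      ENNReal.ofReal (M * (lam * Real.pi * (2 * M)) ^ 2 / m) := by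
  have hm' : (0 : ℝ) < m := by exact_mod_cast hm
  set B : ℕ → Set Plane := fun k =>
    Metric.ball (0 : Plane) ((k + 1 : ℝ) / m) \ Metric.ball 0 ((k : ℝ) / m) with hBdef
  have hBm : ∀ k, MeasurableSet (B k) := fun k =>
    Metric.isOpen_ball.measurableSet.diff Metric.isOpen_ball.measurableSet
  have hBv : ∀ k, volume (B k) = ENNReal.ofReal (Real.pi * (((k + 1 : ℝ) / m) ^ 2 -
      ((k : ℝ) / m) ^ 2)) := fun k => volume_shell (by positivity) (by gcongr; linarith)
  have hsub : {ω | ∃ i j, i ≠ j ∧ ‖X i ω‖ = ‖X j ω‖ ∧ ‖X i ω‖ < M} ⊆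
      ⋃ k ∈ Finset.range (M * m), {ω | 2 ≤ pointCount (fun n => X n ω) (B k)} := by
    rintro ω ⟨i, j, hij, hn, hM⟩
    set k := ⌊‖X i ω‖ * m⌋₊ with hk
    have h1 : (k : ℝ) ≤ ‖X i ω‖ * m := Nat.floor_le (by positivity)
    have h2 : ‖X i ω‖ * m < k + 1 := Nat.lt_floor_add_one _
    have hmem : ∀ x : Plane, ‖x‖ = ‖X i ω‖ → x ∈ B k := by
      intro x hx
      refine ⟨?_, ?_⟩
      · rw [mem_ball_zero_iff, hx, lt_div_iff₀ hm']; exact h2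
      · rw [mem_ball_zero_iff, hx, not_lt, div_le_iff₀ hm']; exact h1
    simp only [mem_iUnion, Finset.mem_range, exists_prop]
    refine ⟨k, ?_, two_le_pointCount hij (hmem _ rfl) (hmem _ hn.symm)⟩
    have : (k : ℝ) < M * m := h1.trans_lt (by gcongr)
    exact_mod_cast this
  refine (measure_mono hsub).trans ((measure_biUnion_finset_le _ _).trans ?_)
  calc ∑ k ∈ Finset.range (M * m), Pr {ω | 2 ≤ pointCount (fun n => X n ω) (B k)}
      ≤ ∑ _k ∈ Finset.range (M * m), ENNReal.ofReal ((lam * Real.pi * (2 * M) / m) ^ 2) := by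
        refine Finset.sum_le_sum fun k hk => ?_
        refine (hX.measure_two_le hlam (hBm k) (by rw [hBv]; exact ENNReal.ofReal_ne_top)).trans ?_
        refine ENNReal.ofReal_le_ofReal ?_
        have hkM : (k : ℝ) + 1 ≤ M * m := by
          have := Finset.mem_range.1 hk
          exact_mod_cast this
        have hd : ((k + 1 : ℝ) / m) ^ 2 - ((k : ℝ) / m) ^ 2 = (2 * k + 1) / m ^ 2 := by
          field_simp; ring
        rw [hBv, hd, ENNReal.toReal_ofReal (by positivity)]
        have : (2 * k + 1 : ℝ) / m ^ 2 ≤ 2 * M / m := by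
          rw [div_le_div_iff₀ (by positivity) hm']
          have : (2 * k + 1 : ℝ) ≤ 2 * (M * m) := by linarith
          nlinarith
        have h3 : lam * (Real.pi * ((2 * k + 1) / m ^ 2)) ≤ lam * Real.pi * (2 * M) / m := by
          calc lam * (Real.pi * ((2 * k + 1) / m ^ 2)) ≤ lam * (Real.pi * (2 * M / m)) := by
                gcongr
            _ = _ := by ring
        gcongr
    _ = ENNReal.ofReal (M * (lam * Real.pi * (2 * M)) ^ 2 / m) := by
        rw [Finset.sum_const, Finset.card_range, nsmul_eq_mul, ← ENNReal.ofReal_natCast,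
          ← ENNReal.ofReal_mul (by positivity)]
        congr 1
        push_cast
        field_simp

lemma IsHomogeneousPPP.ae_norm_injective (hlam : 0 ≤ lam) (hX : IsHomogeneousPPP Pr lam X) :
    ∀ᵐ ω ∂Pr, Function.Injective fun n => ‖X n ω‖ := by
  have h0 : ∀ M : ℕ, Pr {ω | ∃ i j, i ≠ j ∧ ‖X i ω‖ = ‖X j ω‖ ∧ ‖X i ω‖ < M} = 0 := by
    intro M
    refine le_antisymm ?_ bot_le
    have hlim : Tendsto (fun m : ℕ => ENNReal.ofReal (M * (lam * Real.pi * (2 * M)) ^ 2 / m)) atTop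
        (𝓝 0) := by
      rw [← ENNReal.ofReal_zero]
      exact (ENNReal.continuous_ofReal.tendsto _).comp (tendsto_const_div_atTop_nhds_zero_nat _)
    refine ge_of_tendsto hlim ?_
    filter_upwards [eventually_gt_atTop 0] with m hm
    exact hX.measure_tie_le hlam M m hm
  have h1 : ∀ᵐ ω ∂Pr, ∀ M : ℕ, ¬ ∃ i j, i ≠ j ∧ ‖X i ω‖ = ‖X j ω‖ ∧ ‖X i ω‖ < M :=
    ae_all_iff.2 fun M => by rw [ae_iff]; simpa using h0 M
  filter_upwards [h1] with ω hω i j hij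
  by_contra hne
  obtain ⟨M, hM⟩ := exists_nat_gt ‖X i ω‖
  exact hω M ⟨i, j, hne, hij, hM⟩

end PPP

/-! ### Deterministic properties of regular configurations -/

/-- A configuration without ties and without a point at the origin, for which the path losses with
exponent `α` are summable. -/
structure IsRegularConfig (α : ℝ) (x : ℕ → Plane) : Prop where
  summable_one_add : Summable fun n => (1 + ‖x n‖) ^ (-α)
  ne_zero : ∀ n, x n ≠ 0
  injective : Function.Injective fun n => ‖x n‖

/-- The distance of the serving base station. -/
noncomputable def servingDist (x : ℕ → Plane) : ℝ := ‖x (servingBS x)‖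

section Deterministic

variable {α : ℝ} {x : ℕ → Plane}

/-- Summable terms tend to zero, which forces the norms to infinity. A nearest point therefore
exists. -/
lemma IsRegularConfig.tendsto_norm (hα : 0 < α) (hx : IsRegularConfig α x) :
    Tendsto (fun n => ‖x n‖) cofinite atTop := by
  refine tendsto_atTop.2 fun M => ?_
  have h := hx.summable_one_add.tendsto_cofinite_zero
  have hpos : 0 < (1 + max M 0) ^ (-α) := by positivity
  filter_upwards [h.eventually_lt_const hpos] with n hn
  by_contra hlt
  rw [not_le] at hlt
  have hle : 1 + ‖x n‖ ≤ 1 + max M 0 := by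
    have := le_max_left M 0; linarith
  exact absurd hn (not_lt.2 (Real.rpow_le_rpow_of_nonpos (by positivity) hle (by linarith)))

lemma IsRegularConfig.isNearest_servingBS (hα : 0 < α) (hx : IsRegularConfig α x) :
    IsNearest x (servingBS x) := by
  obtain ⟨n, hn⟩ := (hx.tendsto_norm hα).exists_forall_le
  exact Nat.sInf_mem (s := {n | IsNearest x n}) ⟨n, hn⟩

lemma IsRegularConfig.servingDist_pos (hx : IsRegularConfig α x) : 0 < servingDist x :=
  norm_pos_iff.2 (hx.ne_zero _)

lemma IsRegularConfig.servingDist_le (hα : 0 < α) (hx : IsRegularConfig α x) (n : ℕ) :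
    servingDist x ≤ ‖x n‖ := hx.isNearest_servingBS hα n

lemma IsRegularConfig.servingDist_lt (hα : 0 < α) (hx : IsRegularConfig α x) {n : ℕ}
    (hn : n ≠ servingBS x) :
    servingDist x < ‖x n‖ :=
  lt_of_le_of_ne (hx.servingDist_le hα n) fun h => hn (hx.injective h).symm

lemma IsRegularConfig.le_servingDist_iff (hα : 0 < α) (hx : IsRegularConfig α x) (t : ℝ) :
    t ≤ servingDist x ↔ ∀ n, t ≤ ‖x n‖ :=
  ⟨fun h n => h.trans (hx.servingDist_le hα n), fun h => h _⟩

/-- Since ‖x n‖ ≥ r > 0, one has ‖x n‖ ≥ r/(1+r) · (1 + ‖x n‖), which removes the shift by 1. -/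
lemma IsRegularConfig.summable (hα : 0 < α) (hx : IsRegularConfig α x) :
    Summable fun n => ‖x n‖ ^ (-α) := by
  have hr := hx.servingDist_pos
  set r := servingDist x
  refine Summable.of_nonneg_of_le (fun n => by positivity) (fun n => ?_)
    (hx.summable_one_add.mul_left ((r / (1 + r)) ^ (-α)))
  rw [← Real.mul_rpow (by positivity) (by positivity)]
  refine Real.rpow_le_rpow_of_nonpos (by positivity) ?_ (by linarith)
  have := hx.servingDist_le hα n
  rw [div_mul_eq_mul_div, div_le_iff₀ (by positivity)]
  nlinarith

lemma IsRegularConfig.summable_div (hα : 0 < α) (hx : IsRegularConfig α x) {w : ℝ} (hw : 0 < w) :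
    Summable fun n => (‖x n‖ / w) ^ (-α) := by
  simp_rw [Real.div_rpow (norm_nonneg _) hw.le]
  exact (hx.summable hα).div_const _

end Deterministic

/-! ### Measurability of the serving station -/

lemma measurableSet_isNearest (n : ℕ) : MeasurableSet {x : ℕ → Plane | IsNearest x n} := by
  have : {x : ℕ → Plane | IsNearest x n} = ⋂ m, {x | ‖x n‖ ≤ ‖x m‖} := by
    ext x; simp [IsNearest]
  rw [this]
  exact MeasurableSet.iInter fun m => measurableSet_le (by fun_prop) (by fun_prop)

lemma measurable_servingBS : Measurable servingBS := by
  refine measurable_to_countable' fun n => ?_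
  -- The second set covers configurations without a nearest point, where `sInf ∅ = 0`.
  have : servingBS ⁻¹' {n} =
      ({x : ℕ → Plane | IsNearest x n} ∩ ⋂ m : ℕ, ⋂ _ : m < n, {x | IsNearest x m}ᶜ) ∪
        ({x | n = 0} ∩ ⋂ m : ℕ, {x | IsNearest x m}ᶜ) := by
    ext x
    simp only [mem_preimage, mem_singleton_iff, mem_union, mem_inter_iff, mem_ofPred_eq, mem_iInter,
      mem_compl_iff]
    constructor
    · intro h
      by_cases hne : {m | IsNearest x m}.Nonempty
      · left
        refine ⟨h ▸ Nat.sInf_mem hne, fun m hm => ?_⟩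
        exact Nat.notMem_of_lt_sInf (s := {m | IsNearest x m}) (h ▸ hm : m < servingBS x)
      · right
        rw [not_nonempty_iff_eq_empty] at hne
        refine ⟨?_, fun m hm => ?_⟩
        · rw [← h, servingBS, hne, Nat.sInf_empty]
        · exact (hne ▸ (show m ∈ {m | IsNearest x m} from hm) : m ∈ (∅ : Set ℕ))
    · rintro (⟨h1, h2⟩ | ⟨h1, h2⟩)
      · refine le_antisymm (Nat.sInf_le h1) (not_lt.1 fun hlt => ?_)
        exact h2 _ hlt (Nat.sInf_mem (s := {m | IsNearest x m}) ⟨n, h1⟩)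
      · have : {m | IsNearest x m} = ∅ := eq_empty_of_forall_notMem h2
        rw [servingBS, this, Nat.sInf_empty, h1]
  rw [this]
  refine ((measurableSet_isNearest n).inter ?_).union (MeasurableSet.inter (by simp) ?_)
  · exact MeasurableSet.iInter fun m => MeasurableSet.iInter fun _ =>
      (measurableSet_isNearest m).compl
  · exact MeasurableSet.iInter fun m => (measurableSet_isNearest m).compl

lemma measurable_apply_servingBS {β : Type*} [MeasurableSpace β] :
    Measurable fun p : (ℕ → Plane) × (ℕ → β) => p.2 (servingBS p.1) := by
  refine measurable_from_prod_countable_right (f := fun q : ℕ × (ℕ → β) => q.2 q.1) ?_ |>.comp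
    ((measurable_servingBS.comp measurable_fst).prodMk measurable_snd)
  exact fun n => measurable_pi_apply n

lemma measurable_servingDist : Measurable servingDist :=
  (measurable_apply_servingBS.comp (measurable_id.prodMk measurable_id)).norm

/-! ### Void events and the Laplace functional -/

section PPP

variable {Ω : Type*} [MeasurableSpace Ω] {Pr : Measure Ω} [IsProbabilityMeasure Pr] {lam : ℝ}
  {X : ℕ → Ω → Plane}

lemma IsHomogeneousPPP.ae_isRegularConfig (hlam : 0 ≤ lam) (hX : IsHomogeneousPPP Pr lam X) {α : ℝ}
    (hα : 2 < α) : ∀ᵐ ω ∂Pr, IsRegularConfig α fun n => X n ω := by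
  filter_upwards [hX.ae_summable hlam hα, hX.ae_ne_zero hlam, hX.ae_norm_injective hlam]
    with ω h1 h2 h3
  exact ⟨h1, h2, h3⟩

omit [IsProbabilityMeasure Pr] in
lemma IsHomogeneousPPP.measurableSet_void (hX : IsHomogeneousPPP Pr lam X) (t : ℝ) :
    MeasurableSet {ω | ∀ n, t ≤ ‖X n ω‖} := by
  simp only [ofPred_forall]
  exact MeasurableSet.iInter fun n => measurableSet_le measurable_const (hX.measurable n).norm

/-- Weight ⊤ on the ball makes exp(-∑) the indicator of the void event. As f vanishes there, the
Laplace functional of the sum of the two weights splits into two factors. -/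
lemma IsHomogeneousPPP.setLIntegral_void_aux (hlam : 0 ≤ lam) (hX : IsHomogeneousPPP Pr lam X)
    {f : Plane → ℝ≥0∞} (hf : Measurable f) {t : ℝ} (hft : ∀ x ∈ Metric.ball (0 : Plane) t, f x = 0) :
    ∫⁻ ω in {ω | ∀ n, t ≤ ‖X n ω‖}, expNeg (∑' n, f (X n ω)) ∂Pr =
      expNeg (ENNReal.ofReal lam * volume (Metric.ball (0 : Plane) t)) *
        expNeg (ENNReal.ofReal lam * ∫⁻ x, (1 - expNeg (f x))) := by
  have hball : MeasurableSet (Metric.ball (0 : Plane) t) := Metric.isOpen_ball.measurableSet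
  have hm : Measurable ((Metric.ball (0 : Plane) t).indicator fun _ => (⊤ : ℝ≥0∞)) :=
    measurable_const.indicator hball
  have h := hX.laplace hlam (hf.add hm)
  rw [← lintegral_indicator (hX.measurableSet_void t), ← expNeg_add, ← mul_add]
  convert h using 1
  · refine lintegral_congr fun ω => ?_
    by_cases hω : ∀ n, t ≤ ‖X n ω‖
    · rw [indicator_of_mem (by exact hω)]
      congr 1
      refine tsum_congr fun n => ?_
      rw [Pi.add_apply, indicator_of_notMem (by simpa using hω n), add_zero]
    · rw [indicator_of_notMem (by exact hω)]
      push Not at hω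
      obtain ⟨n, hn⟩ := hω
      rw [ENNReal.tsum_eq_top_of_eq_top ⟨n, ?_⟩, expNeg_top]
      rw [Pi.add_apply, indicator_of_mem (by simpa using hn), add_top]
  · congr 2
    rw [← lintegral_indicator_one hball,
      ← lintegral_add_left (measurable_one.indicator hball)]
    refine lintegral_congr fun x => ?_
    by_cases hx : x ∈ Metric.ball (0 : Plane) t
    · simp [hx, hft x hx, expNeg_zero, expNeg_top]
    · simp [hx]

lemma IsHomogeneousPPP.measure_void (hlam : 0 ≤ lam) (hX : IsHomogeneousPPP Pr lam X) (t : ℝ) :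
    Pr {ω | ∀ n, t ≤ ‖X n ω‖} =
      expNeg (ENNReal.ofReal lam * volume (Metric.ball (0 : Plane) t)) := by
  have := hX.setLIntegral_void_aux hlam (f := fun _ => 0) measurable_const (t := t) (by simp)
  simpa [expNeg_zero] using this

/-- Conditionally on the distance of the nearest point being in `[s, t)`, the Laplace functional
of a function which vanishes on the ball of radius `t` is the unconditional one. -/
lemma IsHomogeneousPPP.setLIntegral_shell (hlam : 0 ≤ lam) (hX : IsHomogeneousPPP Pr lam X)
    {f : Plane → ℝ≥0∞} (hf : Measurable f) {s t : ℝ} (hst : s ≤ t)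
    (hft : ∀ x ∈ Metric.ball (0 : Plane) t, f x = 0) :
    ∫⁻ ω in {ω | ∀ n, s ≤ ‖X n ω‖} \ {ω | ∀ n, t ≤ ‖X n ω‖}, expNeg (∑' n, f (X n ω)) ∂Pr =
      Pr ({ω | ∀ n, s ≤ ‖X n ω‖} \ {ω | ∀ n, t ≤ ‖X n ω‖}) *
        expNeg (ENNReal.ofReal lam * ∫⁻ x, (1 - expNeg (f x))) := by
  set A := {ω | ∀ n, s ≤ ‖X n ω‖}
  set B := {ω | ∀ n, t ≤ ‖X n ω‖}
  have hB : MeasurableSet B := hX.measurableSet_void t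
  have hBA : B ⊆ A := fun ω h n => hst.trans (h n)
  -- Both void events carry the same Laplace factor, because f vanishes on the larger ball. The
  -- shell case follows by subtraction.
  have h1 := lintegral_inter_add_sdiff (μ := Pr) (fun ω => expNeg (∑' n, f (X n ω))) A hB
  rw [inter_eq_self_of_subset_right hBA, hX.setLIntegral_void_aux hlam hf hft,
    hX.setLIntegral_void_aux hlam hf
      (fun x hx => hft x (Metric.ball_subset_ball hst hx)),
    ← hX.measure_void hlam, ← hX.measure_void hlam] at h1
  have h2 := measure_inter_add_sdiff (μ := Pr) A hB
  rw [inter_eq_self_of_subset_right hBA] at h2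
  change _ = Pr A * _ at h1
  rw [← h2, add_mul] at h1
  exact (ENNReal.add_right_inj (ENNReal.mul_ne_top (measure_ne_top _ _) (expNeg_ne_top _))).1 h1

end PPP

/-! ### Radial losses and polar coordinates -/

/-- The hypotheses on a radial exponent `F` which make `∑ F (‖x n‖ / r)` converge. -/
structure IsPathLoss (α C : ℝ) (F : ℝ → ℝ) : Prop where
  measurable : Measurable F
  nonneg : ∀ u, 0 < u → 0 ≤ F u
  continuousOn : ContinuousOn F (Ioi 0)
  le : ∀ u, 0 < u → F u ≤ C * u ^ (-α)

/-- The function `F (‖x‖ / w)` outside the ball of radius `w`. -/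
noncomputable def outerLoss (F : ℝ → ℝ) (w : ℝ) (x : Plane) : ℝ≥0∞ :=
  if w ≤ ‖x‖ then ENNReal.ofReal (F (‖x‖ / w)) else 0

/-- The integral `∫_1^∞ (1 - e^{-F(u)}) u du`. -/
noncomputable def outerIntegral (F : ℝ → ℝ) : ℝ := ∫ u in Ioi (1 : ℝ), (1 - Real.exp (-F u)) * u

section Radial

variable {α C : ℝ} {F : ℝ → ℝ}

lemma IsPathLoss.one_sub_exp_nonneg (hF : IsPathLoss α C F) {u : ℝ} (hu : 0 < u) :
    0 ≤ 1 - Real.exp (-F u) := by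
  have := Real.exp_le_one_iff.2 (neg_nonpos.2 (hF.nonneg u hu))
  linarith

/-- The bound 1 - e^{-F} ≤ F ≤ C u^{-α} leaves C u^{1-α}, which is integrable at infinity as α > 2.
-/
lemma IsPathLoss.integrableOn (hα : 2 < α) (hF : IsPathLoss α C F) :
    IntegrableOn (fun u => (1 - Real.exp (-F u)) * u) (Ioi 1) := by
  have hi : IntegrableOn (fun u : ℝ => C * u ^ (-α + 1)) (Ioi 1) :=
    (integrableOn_Ioi_rpow_of_lt (by linarith) one_pos).const_mul C
  have hm := hF.measurable
  refine hi.mono' (by fun_prop) ?_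
  refine (ae_restrict_iff' measurableSet_Ioi).2 (Eventually.of_forall fun u hu => ?_)
  have hu0 : (0 : ℝ) < u := one_pos.trans hu
  rw [Real.norm_of_nonneg (mul_nonneg (hF.one_sub_exp_nonneg hu0) hu0.le), Real.rpow_add hu0,
    Real.rpow_one, ← mul_assoc]
  gcongr
  have h1 := Real.add_one_le_exp (-F u)
  have h2 := hF.le u hu0
  linarith

lemma IsPathLoss.outerIntegral_nonneg (hF : IsPathLoss α C F) : 0 ≤ outerIntegral F :=
  setIntegral_nonneg measurableSet_Ioi fun _ hu =>
    mul_nonneg (hF.one_sub_exp_nonneg (one_pos.trans hu)) (one_pos.trans hu).le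

/-- Polar coordinates, then the scaling ‖x‖ = w u, which produces the factor w². -/
lemma IsPathLoss.lintegral_outerLoss (hα : 2 < α) (hF : IsPathLoss α C F) {w : ℝ} (hw : 0 < w) :
    ∫⁻ x, (1 - expNeg (outerLoss F w x)) =
      ENNReal.ofReal (2 * Real.pi * w ^ 2 * outerIntegral F) := by
  set H : ℝ → ℝ := fun u => (1 - Real.exp (-F u)) * u with hH
  set φ : ℝ → ℝ := (Ici w).indicator fun u => 1 - Real.exp (-F (u / w)) with hφ
  have hφ0 : ∀ u, 0 ≤ φ u := fun u => by
    by_cases hu : u ∈ Ici w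
    · rw [hφ, indicator_of_mem hu]
      exact hF.one_sub_exp_nonneg (div_pos (hw.trans_le hu) hw)
    · rw [hφ, indicator_of_notMem hu]
  have hpt : ∀ x : Plane, 1 - expNeg (outerLoss F w x) = ENNReal.ofReal (φ ‖x‖) := by
    intro x
    by_cases hx : w ≤ ‖x‖
    · have h0 : 0 < ‖x‖ / w := div_pos (hw.trans_le hx) hw
      rw [outerLoss, if_pos hx, hφ, indicator_of_mem (by exact hx),
        expNeg_ofReal (hF.nonneg _ h0), ENNReal.ofReal_sub _ (Real.exp_pos _).le,
        ENNReal.ofReal_one]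
    · rw [outerLoss, if_neg hx, hφ, indicator_of_notMem (by exact hx), expNeg_zero]
      simp
  have hdim : Module.finrank ℝ Plane = 2 := by simp
  have hk : (fun y : ℝ => y ^ (Module.finrank ℝ Plane - 1) • φ y) =
      (Ici w).indicator fun y => w * H (w⁻¹ * y) := by
    funext y
    by_cases hy : y ∈ Ici w
    · rw [hφ, indicator_of_mem hy, indicator_of_mem hy, hdim]
      simp only [hH, smul_eq_mul]
      rw [inv_mul_eq_div]
      field_simp
      norm_num
    · rw [hφ, indicator_of_notMem hy, indicator_of_notMem hy, smul_zero]
  have hint : IntegrableOn (fun y => w * H (w⁻¹ * y)) (Ici w) := by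
    rw [integrableOn_Ici_iff_integrableOn_Ioi]
    refine Integrable.const_mul ?_ w
    have := (integrableOn_Ioi_comp_mul_left_iff H w (inv_pos.2 hw)).2
    rw [inv_mul_cancel₀ hw.ne'] at this
    exact this (hF.integrableOn hα)
  have hI : Integrable (fun x : Plane => φ ‖x‖) := by
    rw [integrable_fun_norm_addHaar volume, hk]
    exact ((integrable_indicator_iff measurableSet_Ici).2 hint).integrableOn
  simp_rw [hpt]
  rw [← ofReal_integral_eq_lintegral_ofReal hI (Eventually.of_forall fun x => hφ0 _),
    integral_fun_norm_addHaar volume φ, hk, setIntegral_indicator measurableSet_Ici,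
    inter_eq_self_of_subset_right (show Ici w ⊆ Ioi 0 from fun y hy => hw.trans_le hy),
    integral_Ici_eq_integral_Ioi,
    integral_const_mul, integral_comp_mul_left_Ioi H w (inv_pos.2 hw), inv_mul_cancel₀ hw.ne',
    hdim, Measure.real, volume_plane_ball zero_le_one,
    ENNReal.toReal_ofReal (by positivity)]
  congr 1
  simp only [smul_eq_mul, inv_inv, nsmul_eq_mul, outerIntegral, hH]
  push_cast
  ring

lemma measurable_outerLoss (hF : Measurable F) :
    Measurable fun p : ℝ × Plane => outerLoss F p.1 p.2 := by
  refine Measurable.ite (measurableSet_le measurable_fst measurable_snd.norm) ?_ measurable_const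
  exact (hF.comp (measurable_snd.norm.div measurable_fst)).ennreal_ofReal

end Radial

/-! ### The exponential law -/

section ExpLaw

lemma expMeasure_Ici {μ : ℝ} (hμ : 0 < μ) {t : ℝ} (ht : 0 ≤ t) :
    expMeasure μ (Ici t) = ENNReal.ofReal (Real.exp (-(μ * t))) := by
  have := isProbabilityMeasure_expMeasure hμ
  have hna : expMeasure μ {t} = 0 := by
    rw [expMeasure, gammaMeasure]
    exact withDensity_absolutelyContinuous _ _ (measure_singleton t)
  have h1 : (expMeasure μ).real (Iic t) = 1 - Real.exp (-(μ * t)) := by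
    rw [← cdf_eq_real, cdf_expMeasure_eq hμ, if_pos ht]
  have h2 : (expMeasure μ).real (Ioi t) = Real.exp (-(μ * t)) := by
    rw [← compl_Iic, probReal_compl_eq_one_sub measurableSet_Iic, h1]; ring
  rw [← h2, ofReal_measureReal, ← Ioi_union_left, measure_union (by simp) (measurableSet_singleton _),
    hna, add_zero]

lemma expMeasure_Iio_zero {μ : ℝ} (hμ : 0 < μ) : expMeasure μ (Iio 0) = 0 := by
  have := isProbabilityMeasure_expMeasure hμ
  rw [← compl_Ici, prob_compl_eq_zero_iff measurableSet_Ici, expMeasure_Ici hμ le_rfl]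
  simp

lemma lintegral_expMeasure (μ : ℝ) {G : ℝ → ℝ≥0∞} (hG : Measurable G) :
    ∫⁻ v, G v ∂expMeasure μ =
      ∫⁻ v in Ioi 0, ENNReal.ofReal (μ * Real.exp (-(μ * v))) * G v := by
  have h : expMeasure μ = volume.withDensity (exponentialPDF μ) := rfl
  have hm : Measurable (exponentialPDF μ) := (measurable_exponentialPDFReal μ).ennreal_ofReal
  rw [h, lintegral_withDensity_eq_lintegral_mul _ hm hG, setLIntegral_congr Ioi_ae_eq_Ici,
    ← lintegral_indicator measurableSet_Ici]
  refine lintegral_congr fun v => ?_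
  by_cases hv : 0 ≤ v
  · rw [Pi.mul_apply, indicator_of_mem (by exact hv), exponentialPDF_of_nonneg hv]
  · rw [Pi.mul_apply, indicator_of_notMem (by exact hv), exponentialPDF_of_neg (not_le.1 hv),
      zero_mul]

end ExpLaw

/-! ### Law of the serving distance and averaging over the other stations -/

section Key

variable {Ω : Type*} [MeasurableSpace Ω] {Pr : Measure Ω} [IsProbabilityMeasure Pr] {lam : ℝ}
  {X : ℕ → Ω → Plane} {α C : ℝ} {F : ℝ → ℝ}

omit [IsProbabilityMeasure Pr] in
lemma IsHomogeneousPPP.measurable_config (hX : IsHomogeneousPPP Pr lam X) :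
    Measurable fun ω n => X n ω := measurable_pi_lambda _ hX.measurable

lemma IsHomogeneousPPP.measure_le_servingDist (hlam : 0 ≤ lam) (hX : IsHomogeneousPPP Pr lam X)
    {t : ℝ} (ht : 0 ≤ t) :
    Pr {ω | t ≤ servingDist fun n => X n ω} = ENNReal.ofReal (Real.exp (-(lam * (Real.pi * t ^ 2)))) := by
  rw [← expNeg_ofReal (by positivity), ENNReal.ofReal_mul hlam, ← volume_plane_ball ht,
    ← hX.measure_void hlam]
  refine measure_congr ?_
  -- Any exponent above 2 serves here, since the statement does not involve one.
  filter_upwards [hX.ae_isRegularConfig hlam (α := 3) (by norm_num)] with ω hω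
  exact propext (hω.le_servingDist_iff (by norm_num) t)

/-- The squared distance of the nearest base station is exponentially distributed. -/
lemma IsHomogeneousPPP.map_servingDist_sq (hlam : 0 < lam) (hX : IsHomogeneousPPP Pr lam X) :
    Pr.map (fun ω => (servingDist fun n => X n ω) ^ 2) = expMeasure (Real.pi * lam) := by
  have hm : Measurable fun ω => (servingDist fun n => X n ω) ^ 2 :=
    (measurable_servingDist.comp hX.measurable_config).pow_const 2
  have hpos : 0 < Real.pi * lam := by positivity
  have := isProbabilityMeasure_expMeasure hpos
  have : IsProbabilityMeasure (Pr.map fun ω => (servingDist fun n => X n ω) ^ 2) :=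
    Measure.isProbabilityMeasure_map hm.aemeasurable
  refine Measure.ext_of_Ici _ _ fun t => ?_
  rw [Measure.map_apply hm measurableSet_Ici]
  rcases le_or_gt 0 t with ht | ht
  · rw [expMeasure_Ici hpos ht]
    have : (fun ω => (servingDist fun n => X n ω) ^ 2) ⁻¹' Ici t =
        {ω | √t ≤ servingDist fun n => X n ω} := by
      ext ω
      exact (Real.sqrt_le_left (norm_nonneg _)).symm
    rw [this, hX.measure_le_servingDist hlam.le (Real.sqrt_nonneg _), Real.sq_sqrt ht]
    congr 2; ring
  · have h1 : (fun ω => (servingDist fun n => X n ω) ^ 2) ⁻¹' Ici t = univ :=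
      eq_univ_of_forall fun ω => ht.le.trans (sq_nonneg _)
    rw [h1, measure_univ]
    refine le_antisymm ?_ prob_le_one
    have h2 := expMeasure_Ici hpos le_rfl
    rw [mul_zero, neg_zero, Real.exp_zero, ENNReal.ofReal_one] at h2
    exact h2 ▸ measure_mono (Ici_subset_Ici.2 ht.le)

lemma IsHomogeneousPPP.lintegral_servingDist (hlam : 0 < lam) (hX : IsHomogeneousPPP Pr lam X)
    {G : ℝ → ℝ≥0∞} (hG : Measurable G) :
    ∫⁻ ω, G (servingDist fun n => X n ω) ∂Pr =
      ∫⁻ v in Ioi 0, ENNReal.ofReal (Real.pi * lam * Real.exp (-(Real.pi * lam * v))) * G √v := by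
  have hm : Measurable fun ω => (servingDist fun n => X n ω) ^ 2 :=
    (measurable_servingDist.comp hX.measurable_config).pow_const 2
  have hG' : Measurable fun v => G √v := hG.comp Real.continuous_sqrt.measurable
  rw [← lintegral_expMeasure _ hG', ← hX.map_servingDist_sq hlam, lintegral_map hG' hm]
  refine lintegral_congr fun ω => ?_
  rw [Real.sqrt_sq (show 0 ≤ servingDist fun n => X n ω from norm_nonneg _)]

/-- `r` rounded up to the grid of mesh `1 / (m + 1)`. -/
noncomputable def gridUp (m : ℕ) (r : ℝ) : ℝ := (⌊r * (m + 1)⌋₊ + 1) / (m + 1)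

lemma measurable_gridUp (m : ℕ) : Measurable (gridUp m) := by
  unfold gridUp
  have : Measurable fun r : ℝ => ((⌊r * (m + 1)⌋₊ : ℕ) : ℝ) :=
    measurable_from_top.comp (Nat.measurable_floor.comp (by fun_prop))
  fun_prop

/-- The strict inequality matters: it makes `outerLoss` at the rounded radius omit the serving
station. -/
lemma lt_gridUp (m : ℕ) (r : ℝ) : r < gridUp m r := by
  rw [gridUp, lt_div_iff₀ (by positivity)]
  exact Nat.lt_floor_add_one _

lemma gridUp_le (m : ℕ) {r : ℝ} (hr : 0 ≤ r) : gridUp m r ≤ r + 1 / (m + 1) := by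
  have : (⌊r * (m + 1)⌋₊ : ℝ) ≤ r * (m + 1) := Nat.floor_le (by positivity)
  rw [gridUp, div_le_iff₀ (by positivity), add_mul, one_div, inv_mul_cancel₀ (by positivity)]
  linarith

lemma tendsto_gridUp {r : ℝ} (hr : 0 ≤ r) : Tendsto (fun m => gridUp m r) atTop (𝓝 r) := by
  have h : Tendsto (fun m : ℕ => r + 1 / ((m : ℝ) + 1)) atTop (𝓝 (r + 0)) :=
    tendsto_const_nhds.add tendsto_one_div_add_atTop_nhds_zero_nat
  rw [add_zero] at h
  exact tendsto_of_tendsto_of_tendsto_of_le_of_le tendsto_const_nhds h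
    (fun m => (lt_gridUp m r).le) fun m => gridUp_le m hr

/-- The conditional Laplace functional, with the serving distance rounded up to a grid. -/
lemma IsHomogeneousPPP.lintegral_gridUp (hlam : 0 ≤ lam) (hX : IsHomogeneousPPP Pr lam X)
    (hα : 2 < α) (hF : IsPathLoss α C F) {κ : ℝ → ℝ≥0∞} (m : ℕ) :
    ∫⁻ ω, κ (gridUp m (servingDist fun n => X n ω)) *
        expNeg (∑' n, outerLoss F (gridUp m (servingDist fun n => X n ω)) (X n ω)) ∂Pr =
      ∫⁻ ω, κ (gridUp m (servingDist fun n => X n ω)) *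
        expNeg (ENNReal.ofReal lam * ENNReal.ofReal
          (2 * Real.pi * gridUp m (servingDist fun n => X n ω) ^ 2 * outerIntegral F)) ∂Pr := by
  have hm : (0 : ℝ) < m + 1 := by positivity
  have hsd : Measurable fun ω => servingDist fun n => X n ω :=
    measurable_servingDist.comp hX.measurable_config
  set A : ℕ → Set Ω := fun k => {ω | ⌊(servingDist fun n => X n ω) * (m + 1)⌋₊ = k} with hA
  have hAm : ∀ k, MeasurableSet (A k) := fun k =>
    (Nat.measurable_floor.comp (hsd.mul_const _)) (measurableSet_singleton k)
  have hAd : Pairwise (Function.onFun Disjoint A) := by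
    intro i j hij
    refine Set.disjoint_left.2 fun ω h h' => hij ?_
    exact (show _ = i from h).symm.trans h'
  have hAU : ⋃ k, A k = univ := eq_univ_of_forall fun ω => mem_iUnion.2 ⟨_, rfl⟩
  rw [← setLIntegral_univ, ← hAU, lintegral_iUnion hAm hAd,
    ← setLIntegral_univ (μ := Pr) (f := fun ω => κ _ * expNeg (ENNReal.ofReal lam * _)), ← hAU,
    lintegral_iUnion hAm hAd]
  refine tsum_congr fun k => ?_
  set w : ℝ := ((k : ℝ) + 1) / (m + 1) with hw
  have hw0 : 0 < w := by positivity
  have hgrid : ∀ ω ∈ A k, gridUp m (servingDist fun n => X n ω) = w := by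
    intro ω hω
    have : ⌊(servingDist fun n => X n ω) * (m + 1)⌋₊ = k := hω
    rw [gridUp, this]
  -- On the k-th cell the rounded radius is the constant w, and the cell is almost surely the shell
  -- event k/(m+1) ≤ r < w.
  have hAV : (A k : Set Ω) =ᵐ[Pr]
      ({ω | ∀ n, (k : ℝ) / (m + 1) ≤ ‖X n ω‖} \ {ω | ∀ n, w ≤ ‖X n ω‖} : Set Ω) := by
    filter_upwards [hX.ae_isRegularConfig hlam hα] with ω hω
    have h1 := hω.le_servingDist_iff (by linarith) ((k : ℝ) / (m + 1))
    have h2 := hω.le_servingDist_iff (by linarith) w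
    refine propext (Iff.trans (?_ : ω ∈ A k ↔ _) (and_congr h1 (not_congr h2)))
    rw [not_le, hw, lt_div_iff₀ hm, div_le_iff₀ hm]
    exact Nat.floor_eq_iff (mul_nonneg (norm_nonneg _) hm.le)
  have hfm : Measurable (outerLoss F w) :=
    (measurable_outerLoss hF.measurable).comp (measurable_const.prodMk measurable_id)
  have hl : ∀ ω ∈ A k, κ (gridUp m (servingDist fun n => X n ω)) *
      expNeg (∑' n, outerLoss F (gridUp m (servingDist fun n => X n ω)) (X n ω)) =
      κ w * expNeg (∑' n, outerLoss F w (X n ω)) := fun ω hω => by rw [hgrid ω hω]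
  have hr : ∀ ω ∈ A k, κ (gridUp m (servingDist fun n => X n ω)) *
      expNeg (ENNReal.ofReal lam * ENNReal.ofReal
        (2 * Real.pi * gridUp m (servingDist fun n => X n ω) ^ 2 * outerIntegral F)) =
      κ w * expNeg (ENNReal.ofReal lam * ENNReal.ofReal
        (2 * Real.pi * w ^ 2 * outerIntegral F)) := fun ω hω => by rw [hgrid ω hω]
  have hme : Measurable fun ω => expNeg (∑' n, outerLoss F w (X n ω)) :=
    measurable_expNeg.comp (Measurable.tsum fun n => hfm.comp (hX.measurable n))
  have hst : (k : ℝ) / (m + 1) ≤ w := by rw [hw]; gcongr; linarith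
  have hft : ∀ x ∈ Metric.ball (0 : Plane) w, outerLoss F w x = 0 := fun x hx => by
    rw [outerLoss, if_neg]
    simpa using hx
  rw [setLIntegral_congr_fun (hAm k) hl, setLIntegral_congr_fun (hAm k) hr,
    lintegral_const_mul _ hme, lintegral_const, Measure.restrict_apply_univ,
    setLIntegral_congr hAV, hX.setLIntegral_shell hlam hfm hst hft,
    hF.lintegral_outerLoss hα hw0, measure_congr hAV,
    mul_comm (Pr _) (expNeg _), ← mul_assoc]

/-- The expectation of `κ (r) exp (-∑_{z ≠ y} F (R_z / r))`, in terms of the distance `r` of the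
nearest base station alone. -/
lemma IsHomogeneousPPP.lintegral_exp_pathLoss (hlam : 0 ≤ lam) (hX : IsHomogeneousPPP Pr lam X)
    (hα : 2 < α) (hF : IsPathLoss α C F) {κ : ℝ → ℝ≥0∞} (hκ : Continuous κ) (hκ1 : ∀ r, κ r ≤ 1) :
    ∫⁻ ω, κ (servingDist fun n => X n ω) * expNeg (ENNReal.ofReal
        (∑' n, if n = servingBS (fun n => X n ω) then 0 else
          F (‖X n ω‖ / servingDist fun n => X n ω))) ∂Pr =
      ∫⁻ ω, κ (servingDist fun n => X n ω) * expNeg (ENNReal.ofReal lam * ENNReal.ofReal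
          (2 * Real.pi * (servingDist fun n => X n ω) ^ 2 * outerIntegral F)) ∂Pr := by
  have hsd : Measurable fun ω => servingDist fun n => X n ω :=
    measurable_servingDist.comp hX.measurable_config
  have hgm : ∀ m, Measurable fun ω => gridUp m (servingDist fun n => X n ω) := fun m =>
    (measurable_gridUp m).comp hsd
  have hle : ∀ r z, κ r * expNeg z ≤ 1 := fun r z => mul_le_one' (hκ1 r) (expNeg_le_one z)
  have hR : Tendsto (fun m => ∫⁻ ω, κ (gridUp m (servingDist fun n => X n ω)) *
        expNeg (ENNReal.ofReal lam * ENNReal.ofReal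
          (2 * Real.pi * gridUp m (servingDist fun n => X n ω) ^ 2 * outerIntegral F)) ∂Pr) atTop
      (𝓝 (∫⁻ ω, κ (servingDist fun n => X n ω) * expNeg (ENNReal.ofReal lam * ENNReal.ofReal
          (2 * Real.pi * (servingDist fun n => X n ω) ^ 2 * outerIntegral F)) ∂Pr)) := by
    refine tendsto_lintegral_of_dominated_convergence (fun _ => 1) (fun m => ?_)
      (fun m => Eventually.of_forall fun ω => hle _ _) (by simp) (Eventually.of_forall fun ω => ?_)
    · refine (hκ.measurable.comp (hgm m)).mul (measurable_expNeg.comp ?_)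
      exact ((((hgm m).pow_const 2).const_mul _).mul_const _).ennreal_ofReal.const_mul _
    · have ht := tendsto_gridUp (norm_nonneg _ : 0 ≤ servingDist fun n => X n ω)
      refine ENNReal.Tendsto.mul ((hκ.tendsto _).comp ht) (Or.inr (expNeg_ne_top _))
        ((continuous_expNeg.tendsto _).comp (ENNReal.Tendsto.const_mul
          ((ENNReal.continuous_ofReal.tendsto _).comp (((ht.pow 2).const_mul _).mul_const _))
          (Or.inr ENNReal.ofReal_ne_top))) (Or.inr ((hκ1 _).trans_lt ENNReal.one_lt_top).ne)
  have hL : Tendsto (fun m => ∫⁻ ω, κ (gridUp m (servingDist fun n => X n ω)) *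
        expNeg (∑' n, outerLoss F (gridUp m (servingDist fun n => X n ω)) (X n ω)) ∂Pr) atTop
      (𝓝 (∫⁻ ω, κ (servingDist fun n => X n ω) * expNeg (ENNReal.ofReal
        (∑' n, if n = servingBS (fun n => X n ω) then 0 else
          F (‖X n ω‖ / servingDist fun n => X n ω))) ∂Pr)) := by
    refine tendsto_lintegral_of_dominated_convergence (fun _ => 1) (fun m => ?_)
      (fun m => Eventually.of_forall fun ω => hle _ _) (by simp) ?_
    · refine (hκ.measurable.comp (hgm m)).mul (measurable_expNeg.comp ?_)
      exact Measurable.tsum fun n =>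
        (measurable_outerLoss hF.measurable).comp ((hgm m).prodMk (hX.measurable n))
    · filter_upwards [hX.ae_isRegularConfig hlam hα] with ω hω
      set x : ℕ → Plane := fun n => X n ω with hx
      set r := servingDist x with hr
      have hr0 : 0 < r := hω.servingDist_pos
      have ht : Tendsto (fun m => gridUp m r) atTop (𝓝 r) := tendsto_gridUp hr0.le
      refine ENNReal.Tendsto.mul ((hκ.tendsto _).comp ht) (Or.inr (expNeg_ne_top _))
        ((continuous_expNeg.tendsto _).comp ?_) (Or.inr ((hκ1 _).trans_lt ENNReal.one_lt_top).ne)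
      have hC : 0 ≤ C := by
        have h1 := (hF.nonneg 1 one_pos).trans (hF.le 1 one_pos)
        simpa using h1
      have hpos : ∀ n, 0 < ‖x n‖ := fun n => norm_pos_iff.2 (hω.ne_zero n)
      set L : ℕ → ℕ → ℝ := fun m n => if gridUp m r ≤ ‖x n‖ then F (‖x n‖ / gridUp m r) else 0
      have hg0 : ∀ m, 0 < gridUp m r := fun m => hr0.trans (lt_gridUp m r)
      have hL0 : ∀ m n, 0 ≤ L m n := fun m n => by
        simp only [L]; split_ifs
        · exact hF.nonneg _ (div_pos (hpos n) (hg0 m))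
        · exact le_rfl
      -- A dominating sequence uniform in m: every rounded radius is at most r + 1.
      have hsum : Summable fun n => C * (‖x n‖ / (r + 1)) ^ (-α) :=
        (hω.summable_div (by linarith) (by linarith)).mul_left C
      have hbd : ∀ m n, L m n ≤ C * (‖x n‖ / (r + 1)) ^ (-α) := fun m n => by
        simp only [L]; split_ifs
        · refine (hF.le _ (div_pos (hpos n) (hg0 m))).trans ?_
          gcongr 1
          refine Real.rpow_le_rpow_of_nonpos (by have := hpos n; positivity) ?_ (by linarith)
          have h1 : gridUp m r ≤ r + 1 := (gridUp_le m hr0.le).trans (by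
            gcongr; rw [div_le_one (by positivity)]; linarith [(Nat.cast_nonneg m : (0 : ℝ) ≤ m)])
          have := hg0 m
          gcongr
        · have := hpos n; positivity
      have hconv : ∀ m, ∑' n, outerLoss F (gridUp m r) (x n) = ENNReal.ofReal (∑' n, L m n) := by
        intro m
        rw [ENNReal.ofReal_tsum_of_nonneg (hL0 m)
          (Summable.of_nonneg_of_le (hL0 m) (hbd m) hsum)]
        refine tsum_congr fun n => ?_
        simp only [outerLoss, L]
        split_ifs <;> simp
      have hgoal : Tendsto (fun m => ∑' n, L m n) atTop
          (𝓝 (∑' n, if n = servingBS x then 0 else F (‖x n‖ / r))) := by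
        refine tendsto_tsum_of_dominated_convergence hsum (fun n => ?_)
          (Eventually.of_forall fun m n => by
            rw [Real.norm_of_nonneg (hL0 m n)]; exact hbd m n)
        split_ifs with hn
        · refine tendsto_const_nhds.congr fun m => ?_
          simp only [L]
          rw [if_neg]
          rw [hn, not_le]
          exact lt_gridUp m r
        · have h1 : r < ‖x n‖ := hω.servingDist_lt (by linarith) hn
          have h2 : Tendsto (fun m => F (‖x n‖ / gridUp m r)) atTop (𝓝 (F (‖x n‖ / r))) := by
            have h3 : ContinuousAt F (‖x n‖ / r) :=
              hF.continuousOn.continuousAt (Ioi_mem_nhds (div_pos (hpos n) hr0))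
            exact h3.tendsto.comp (tendsto_const_nhds.div ht hr0.ne')
          refine h2.congr' ?_
          filter_upwards [ht.eventually_lt_const h1] with m hm
          simp only [L]
          rw [if_pos hm.le]
      have := (ENNReal.continuous_ofReal.tendsto _).comp hgoal
      exact this.congr fun m => (hconv m).symm
  exact tendsto_nhds_unique hL (hR.congr fun m => (hX.lintegral_gridUp hlam hα hF m).symm)

end Key

/-! ### Exponential fading for fixed weights -/

section Fading

variable {Ω : Type*} [MeasurableSpace Ω] {Pr : Measure Ω} [IsProbabilityMeasure Pr] {μ : ℝ}
  {g : ℕ → Ω → ℝ}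

/-- The integrand times the density is (1 + c)⁻¹ times the density of rate μ(1 + c), whose mass is
one. -/
lemma lintegral_expMeasure_exp {c : ℝ} (hμ : 0 < μ) (hc : 0 ≤ c) :
    ∫⁻ v, ENNReal.ofReal (Real.exp (-(μ * (c * v)))) ∂expMeasure μ =
      ENNReal.ofReal (1 + c)⁻¹ := by
  have hμc : 0 < μ * (1 + c) := by positivity
  have := isProbabilityMeasure_expMeasure hμc
  have h1 := lintegral_expMeasure (μ * (1 + c)) (G := fun _ => 1) measurable_const
  rw [lintegral_one, measure_univ] at h1
  rw [lintegral_expMeasure _ (by fun_prop), ← mul_one (ENNReal.ofReal (1 + c)⁻¹), h1,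
    ← lintegral_const_mul _ (by fun_prop)]
  refine lintegral_congr fun v => ?_
  rw [mul_one, ← ENNReal.ofReal_mul (by positivity), ← ENNReal.ofReal_mul (by positivity),
    mul_assoc, ← Real.exp_add]
  congr 1
  field_simp
  ring_nf

omit [IsProbabilityMeasure Pr] in
lemma ae_nonneg_of_hasLaw_exp (hμ : 0 < μ) (hg : ∀ n, HasLaw (g n) (expMeasure μ) Pr) :
    ∀ᵐ ω ∂Pr, ∀ n, 0 ≤ g n ω := by
  refine ae_all_iff.2 fun n => ?_
  have h : ∀ᵐ v ∂expMeasure μ, 0 ≤ v := by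
    rw [ae_iff]
    convert expMeasure_Iio_zero hμ using 2
    ext v; simp
  rw [← (hg n).map_eq] at h
  exact ae_of_ae_map (hg n).aemeasurable h

omit [IsProbabilityMeasure Pr] in
lemma ae_ne_zero_of_hasLaw_exp (hg : ∀ n, HasLaw (g n) (expMeasure μ) Pr) :
    ∀ᵐ ω ∂Pr, ∀ n, g n ω ≠ 0 := by
  refine ae_all_iff.2 fun n => ?_
  have h : ∀ᵐ v ∂expMeasure μ, v ≠ 0 := by
    rw [ae_iff]
    have : {v : ℝ | ¬ v ≠ 0} = {0} := by ext v; simp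
    rw [this, expMeasure, gammaMeasure]
    exact withDensity_absolutelyContinuous _ _ (measure_singleton 0)
  rw [← (hg n).map_eq] at h
  exact ae_of_ae_map (hg n).aemeasurable h

lemma lintegral_fading_ne_top (hμ : 0 < μ) :
    ∫⁻ v, ENNReal.ofReal v ∂expMeasure μ ≠ ⊤ := by
  rw [lintegral_expMeasure _ (by fun_prop)]
  have h : IntegrableOn (fun v : ℝ => μ * (v ^ (1 : ℝ) * Real.exp (-μ * v))) (Ioi 0) :=
    Integrable.const_mul (by
      have := integrableOn_rpow_mul_exp_neg_mul_rpow (p := 1) (s := 1) (by norm_num) one_pos hμ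
      simpa [IntegrableOn] using this) μ
  refine ne_of_eq_of_ne (setLIntegral_congr_fun measurableSet_Ioi fun v hv => ?_)
    h.lintegral_lt_top.ne
  rw [← ENNReal.ofReal_mul (by positivity), Real.rpow_one]
  congr 1
  ring_nf

omit [IsProbabilityMeasure Pr] in
-- The expected sum is the common finite mean times ∑ c n.
lemma ae_summable_fading (hμ : 0 < μ) (hg : ∀ n, HasLaw (g n) (expMeasure μ) Pr) {c : ℕ → ℝ}
    (hc0 : ∀ n, 0 ≤ c n) (hc : Summable c) : ∀ᵐ ω ∂Pr, Summable fun n => c n * g n ω := by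
  have h1 : ∫⁻ ω, ∑' n, ENNReal.ofReal (c n * g n ω) ∂Pr ≠ ⊤ := by
    rw [lintegral_tsum fun n => ((hg n).aemeasurable.const_mul _).ennreal_ofReal]
    have h2 : ∀ n, ∫⁻ ω, ENNReal.ofReal (c n * g n ω) ∂Pr =
        ENNReal.ofReal (c n) * ∫⁻ v, ENNReal.ofReal v ∂expMeasure μ := fun n => by
      simp_rw [ENNReal.ofReal_mul (hc0 n)]
      rw [lintegral_const_mul' _ _ ENNReal.ofReal_ne_top, ← (hg n).map_eq,
        lintegral_map' (by fun_prop) (hg n).aemeasurable]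
    simp_rw [h2]
    rw [ENNReal.tsum_mul_right, ← ENNReal.ofReal_tsum_of_nonneg hc0 hc]
    exact ENNReal.mul_ne_top ENNReal.ofReal_ne_top (lintegral_fading_ne_top hμ)
  have h2 := ae_lt_top' (AEMeasurable.tsum fun n =>
    ((hg n).aemeasurable.const_mul _).ennreal_ofReal) h1
  filter_upwards [h2, ae_nonneg_of_hasLaw_exp hμ hg] with ω hω h0
  refine (ENNReal.summable_toReal hω.ne).congr fun n => ?_
  rw [ENNReal.toReal_ofReal (mul_nonneg (hc0 n) (h0 n))]

lemma ofReal_inv_one_add {c : ℝ} (hc : 0 ≤ c) :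
    ENNReal.ofReal (1 + c)⁻¹ = expNeg (ENNReal.ofReal (Real.log (1 + c))) := by
  rw [expNeg_ofReal (Real.log_nonneg (by linarith)), Real.exp_neg, Real.exp_log (by linarith)]

/-- Given the other powers, the exponential tail of g y is e^{-μK} ∏ e^{-μ c_n g_n}. Independence
then gives e^{-μK} ∏ (1 + c_n)⁻¹. -/
lemma measure_finset_fading_le (hμ : 0 < μ) (hgm : ∀ n, Measurable (g n))
    (hg : ∀ n, HasLaw (g n) (expMeasure μ) Pr) (hind : iIndepFun g Pr) {c : ℕ → ℝ}
    (hc0 : ∀ n, 0 ≤ c n) {K : ℝ} (hK : 0 ≤ K) {s : Finset ℕ} {y : ℕ} (hy : y ∉ s) :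
    Pr {ω | K + ∑ n ∈ s, c n * g n ω ≤ g y ω} =
      expNeg (ENNReal.ofReal (μ * K + ∑ n ∈ s, Real.log (1 + c n))) := by
  -- Coefficient 1 at y puts g y and the weighted interferers into one independent family.
  set f : ℕ → Ω → ℝ := fun n ω => (if n = y then 1 else c n) * g n ω with hf
  have hfm : ∀ n, Measurable (f n) := fun n => (hgm n).const_mul _
  have hfi : iIndepFun f Pr :=
    hind.comp (fun n v => (if n = y then 1 else c n) * v) fun n => measurable_id.const_mul _
  have hfy : f y = g y := by funext ω; simp [hf]
  have hfs : ∀ ω, (∑ n ∈ s, f n) ω = ∑ n ∈ s, c n * g n ω := fun ω => by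
    rw [Finset.sum_apply]
    refine Finset.sum_congr rfl fun n hn => ?_
    simp only [hf]
    rw [if_neg (ne_of_mem_of_not_mem hn hy)]
  have hW : Measurable (∑ n ∈ s, f n) :=
    by
    rw [show ∑ n ∈ s, f n = fun ω => ∑ n ∈ s, f n ω from funext fun ω => Finset.sum_apply _ _ _]
    exact Finset.measurable_sum s fun n _ => hfm n
  have hprod := (hfi.indepFun_finsetSum_of_notMem hfm hy).map_prod_eq_prod_map_map
    hW.aemeasurable (hfm y).aemeasurable
  have hSm : MeasurableSet {p : ℝ × ℝ | K + p.1 ≤ p.2} :=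
    measurableSet_le (by fun_prop) (by fun_prop)
  have h1 : Pr {ω | K + ∑ n ∈ s, c n * g n ω ≤ g y ω} =
      Pr.map (fun ω => ((∑ n ∈ s, f n) ω, f y ω)) {p : ℝ × ℝ | K + p.1 ≤ p.2} := by
    rw [Measure.map_apply (hW.prodMk (hfm y)) hSm]
    congr 1
    ext ω
    simp only [mem_preimage, mem_ofPred_eq, hfs, hfy]
  rw [h1, hprod, Measure.prod_apply hSm, lintegral_map (measurable_measure_prodMk_left hSm) hW,
    hfy, (hg y).map_eq]
  have h2 : ∀ᵐ ω ∂Pr, expMeasure μ (Prod.mk ((∑ n ∈ s, f n) ω) ⁻¹' {p : ℝ × ℝ | K + p.1 ≤ p.2}) =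
      ENNReal.ofReal (Real.exp (-(μ * K))) *
        ∏ n ∈ s, ENNReal.ofReal (Real.exp (-(μ * (c n * g n ω)))) := by
    filter_upwards [ae_nonneg_of_hasLaw_exp hμ hg] with ω h0
    have h3 : 0 ≤ ∑ n ∈ s, c n * g n ω := Finset.sum_nonneg fun n _ => mul_nonneg (hc0 n) (h0 n)
    have h4 : Prod.mk ((∑ n ∈ s, f n) ω) ⁻¹' {p : ℝ × ℝ | K + p.1 ≤ p.2} =
        Ici (K + ∑ n ∈ s, c n * g n ω) := by
      ext v; simp only [mem_preimage, mem_ofPred_eq, hfs, mem_Ici]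
    rw [h4, expMeasure_Ici hμ (by positivity),
      ← ENNReal.ofReal_prod_of_nonneg (fun n _ => (Real.exp_pos _).le),
      ← ENNReal.ofReal_mul (Real.exp_pos _).le, ← Real.exp_sum, ← Real.exp_add,
      Finset.sum_neg_distrib, ← Finset.mul_sum]
    congr 2; ring
  have hgi : iIndepFun (fun n ω => ENNReal.ofReal (Real.exp (-(μ * (c n * g n ω))))) Pr :=
    hind.comp (fun n v => ENNReal.ofReal (Real.exp (-(μ * (c n * v))))) fun n => by fun_prop
  have hem : ∀ n, Measurable fun ω => ENNReal.ofReal (Real.exp (-(μ * (c n * g n ω)))) :=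
    fun n => by have := hgm n; fun_prop
  rw [lintegral_congr_ae h2, lintegral_const_mul _ (by fun_prop),
    lintegral_prod_eq_prod_lintegral_of_indepFun _ _ hgi hem,
    ENNReal.ofReal_add (by positivity)
      (Finset.sum_nonneg fun n _ => Real.log_nonneg (by linarith [hc0 n])),
    expNeg_add, expNeg_ofReal (by positivity),
    ENNReal.ofReal_sum_of_nonneg (fun n _ => Real.log_nonneg (by linarith [hc0 n])), expNeg_sum]
  congr 1
  refine Finset.prod_congr rfl fun n _ => ?_
  rw [← ofReal_inv_one_add (hc0 n), ← lintegral_expMeasure_exp hμ (hc0 n), ← (hg n).map_eq,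
    lintegral_map (by fun_prop) (hgm n)]

lemma summable_log_one_add {c : ℕ → ℝ} (hc0 : ∀ n, 0 ≤ c n) (hc : Summable c) :
    Summable fun n => Real.log (1 + c n) :=
  Summable.of_nonneg_of_le (fun n => Real.log_nonneg (by linarith [hc0 n]))
    (fun n => by have := Real.log_le_sub_one_of_pos (x := 1 + c n) (by linarith [hc0 n]); linarith)
    hc

/-- Passage to the limit from finite sums. For nonnegative powers the truncated events decrease in
M, and c y = 0 allows y to be erased from each truncation. -/
lemma measure_fading_le (hμ : 0 < μ) (hgm : ∀ n, Measurable (g n))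
    (hg : ∀ n, HasLaw (g n) (expMeasure μ) Pr) (hind : iIndepFun g Pr) {c : ℕ → ℝ}
    (hc0 : ∀ n, 0 ≤ c n) (hc : Summable c) {K : ℝ} (hK : 0 ≤ K) {y : ℕ} (hy : c y = 0) :
    Pr {ω | K + ∑' n, c n * g n ω ≤ g y ω} =
      expNeg (ENNReal.ofReal (μ * K + ∑' n, Real.log (1 + c n))) := by
  set N : Set Ω := {ω | ∀ n, 0 ≤ g n ω} with hN
  have hNm : MeasurableSet N := by
    simp only [hN, ofPred_forall]
    exact MeasurableSet.iInter fun n => measurableSet_le measurable_const (hgm n)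
  have hN1 : Pr Nᶜ = 0 := ae_nonneg_of_hasLaw_exp hμ hg
  set A : ℕ → Set Ω := fun M => {ω | K + ∑ n ∈ Finset.range M, c n * g n ω ≤ g y ω}
  have hAm : ∀ M, MeasurableSet (A M) := fun M => measurableSet_le (by fun_prop) (hgm y)
  have hA : ∀ M, Pr (A M ∩ N) =
      expNeg (ENNReal.ofReal (μ * K + ∑ n ∈ Finset.range M, Real.log (1 + c n))) := by
    intro M
    rw [measure_inter_conull hN1]
    have h1 := measure_finset_fading_le hμ hgm hg hind hc0 hK (Finset.notMem_erase y (Finset.range M))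
    rw [Finset.sum_erase _ (by simp [hy])] at h1
    rw [← h1]
    congr 1
    ext ω
    simp only [A, mem_ofPred_eq]
    rw [Finset.sum_erase _ (by simp [hy])]
  have hanti : Antitone fun M => A M ∩ N := by
    rintro M M' hM ω ⟨h1, h2⟩
    refine ⟨?_, h2⟩
    change K + ∑ n ∈ Finset.range M', c n * g n ω ≤ g y ω at h1
    change K + ∑ n ∈ Finset.range M, c n * g n ω ≤ g y ω
    refine le_trans ?_ h1
    gcongr
    exact fun n _ _ => mul_nonneg (hc0 n) (h2 n)
  have hlim := tendsto_measure_iInter_atTop (μ := Pr)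
    (fun M => ((hAm M).inter hNm).nullMeasurableSet) hanti ⟨0, measure_ne_top _ _⟩
  have hlim' : Tendsto (fun M => expNeg (ENNReal.ofReal
      (μ * K + ∑ n ∈ Finset.range M, Real.log (1 + c n)))) atTop
      (𝓝 (expNeg (ENNReal.ofReal (μ * K + ∑' n, Real.log (1 + c n))))) :=
    (continuous_expNeg.tendsto _).comp ((ENNReal.continuous_ofReal.tendsto _).comp
      (tendsto_const_nhds.add (summable_log_one_add hc0 hc).hasSum.tendsto_sum_nat))
  have hU : Pr {ω | K + ∑' n, c n * g n ω ≤ g y ω} = Pr (⋂ M, A M ∩ N) := by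
    refine measure_congr ?_
    filter_upwards [ae_nonneg_of_hasLaw_exp hμ hg, ae_summable_fading hμ hg hc0 hc] with ω h0 hs
    refine propext ?_
    change K + ∑' n, c n * g n ω ≤ g y ω ↔ ω ∈ ⋂ M, A M ∩ N
    rw [mem_iInter]
    constructor
    · intro h M
      refine ⟨le_trans ?_ h, h0⟩
      gcongr
      exact hs.sum_le_tsum _ fun n _ => mul_nonneg (hc0 n) (h0 n)
    · intro h
      exact le_of_tendsto' (tendsto_const_nhds.add hs.hasSum.tendsto_sum_nat) fun M => (h M).1
  rw [hU]
  refine tendsto_nhds_unique hlim (hlim'.congr fun M => (hA M).symm)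

/-- The strict event contains the non-strict ones with K + 1/(m+1), whose probabilities converge by
continuity in K. -/
lemma measure_fading_lt (hμ : 0 < μ) (hgm : ∀ n, Measurable (g n))
    (hg : ∀ n, HasLaw (g n) (expMeasure μ) Pr) (hind : iIndepFun g Pr) {c : ℕ → ℝ}
    (hc0 : ∀ n, 0 ≤ c n) (hc : Summable c) {K : ℝ} (hK : 0 ≤ K) {y : ℕ} (hy : c y = 0) :
    Pr {ω | K + ∑' n, c n * g n ω < g y ω} =
      expNeg (ENNReal.ofReal (μ * K + ∑' n, Real.log (1 + c n))) := by
  refine le_antisymm ?_ ?_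
  · rw [← measure_fading_le hμ hgm hg hind hc0 hc hK hy]
    exact measure_mono fun ω (h : K + ∑' n, c n * g n ω < g y ω) => h.le
  · have hlim : Tendsto (fun m : ℕ => expNeg (ENNReal.ofReal
        (μ * (K + 1 / ((m : ℝ) + 1)) + ∑' n, Real.log (1 + c n)))) atTop
        (𝓝 (expNeg (ENNReal.ofReal (μ * (K + 0) + ∑' n, Real.log (1 + c n))))) :=
      (continuous_expNeg.tendsto _).comp ((ENNReal.continuous_ofReal.tendsto _).comp
        (((tendsto_const_nhds.add tendsto_one_div_add_atTop_nhds_zero_nat).const_mul _).add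
          tendsto_const_nhds))
    rw [add_zero] at hlim
    refine le_of_tendsto' hlim fun m => ?_
    rw [← measure_fading_le hμ hgm hg hind hc0 hc (by positivity) hy]
    refine measure_mono fun ω (h : K + 1 / ((m : ℝ) + 1) + ∑' n, c n * g n ω ≤ g y ω) => ?_
    change K + ∑' n, c n * g n ω < g y ω
    have : (0 : ℝ) < 1 / (m + 1) := by positivity
    linarith

end Fading

/-! ### The SINR for fixed base stations -/

section Sinr

variable {Ω : Type*} [MeasurableSpace Ω] {Pr : Measure Ω} [IsProbabilityMeasure Pr] {μ α : ℝ}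
  {g : ℕ → Ω → ℝ} {x : ℕ → Plane}

/-- The exponent `log (1 + a u^{-α})`. -/
noncomputable def fadingLoss (α a u : ℝ) : ℝ := Real.log (1 + a * u ^ (-α))

/-- The constant a comes from log(1 + y) ≤ y. -/
lemma isPathLoss_fadingLoss {a : ℝ} (ha : 0 ≤ a) : IsPathLoss α a (fadingLoss α a) where
  measurable := by unfold fadingLoss; fun_prop
  nonneg u hu := Real.log_nonneg (by have : 0 ≤ a * u ^ (-α) := by positivity
                                     linarith)
  continuousOn := by
    intro u hu
    have hu0 : (0 : ℝ) < u := hu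
    refine ContinuousAt.continuousWithinAt ?_
    unfold fadingLoss
    have h1 : ContinuousAt (fun u : ℝ => u ^ (-α)) u := Real.continuousAt_rpow_const _ _ (Or.inl hu0.ne')
    have : 0 ≤ a * u ^ (-α) := by positivity
    exact ContinuousAt.log (f := fun u : ℝ => 1 + a * u ^ (-α))
      (continuousAt_const.add (continuousAt_const.mul h1)) (by linarith)
  le u hu := by
    have : 0 ≤ a * u ^ (-α) := by positivity
    have := Real.log_le_sub_one_of_pos (x := 1 + a * u ^ (-α)) (by linarith)
    unfold fadingLoss
    linarith

omit [IsProbabilityMeasure Pr] in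
lemma IsRegularConfig.ae_summable_interferenceTerm (hα : 0 < α) (hx : IsRegularConfig α x)
    (hμ : 0 < μ) (hg : ∀ n, HasLaw (g n) (expMeasure μ) Pr) :
    ∀ᵐ ω ∂Pr, Summable (interferenceTerm α x fun n => g n ω) := by
  filter_upwards [ae_summable_fading hμ hg
    (c := fun n => if n = servingBS x then 0 else ‖x n‖ ^ (-α))
    (fun n => by split_ifs <;> positivity)
    (Summable.of_nonneg_of_le (fun n => by split_ifs <;> positivity)
      (fun n => by split_ifs; positivity; exact le_rfl) (hx.summable hα))] with ω hω
  refine hω.congr fun n => ?_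
  unfold interferenceTerm
  split_ifs
  · simp
  · rw [mul_comm]

/-- The exponent of the coverage probability given the base stations. -/
noncomputable def coverageExponent (α k a : ℝ) (x : ℕ → Plane) : ℝ :=
  k * servingDist x ^ α +
    ∑' n, if n = servingBS x then 0 else fadingLoss α a (‖x n‖ / servingDist x)

/-- Clearing the denominator and multiplying by r^α / P₀ reduces the event to K + ∑ c_n g_n ≤ g_y.
Both inequalities are needed: ≥ for the complement of the edge event, > for coverage. -/
lemma IsRegularConfig.measure_sinr (hα : 0 < α) (hx : IsRegularConfig α x)
    (hμ : 0 < μ) (hgm : ∀ n, Measurable (g n)) (hg : ∀ n, HasLaw (g n) (expMeasure μ) Pr)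
    (hind : iIndepFun g Pr) {t N P₀ P₁ : ℝ} (ht : 0 < t) (hN : 0 ≤ N) (hP₀ : 0 < P₀)
    (hP₁ : 0 < P₁) :
    Pr {ω | t ≤ sinr α N P₀ P₁ x fun n => g n ω} =
        expNeg (ENNReal.ofReal (coverageExponent α (μ * (t * N / P₀)) (t * P₁ / P₀) x)) ∧
      Pr {ω | t < sinr α N P₀ P₁ x fun n => g n ω} =
        expNeg (ENNReal.ofReal (coverageExponent α (μ * (t * N / P₀)) (t * P₁ / P₀) x)) := by
  have hr : 0 < servingDist x := hx.servingDist_pos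
  set y := servingBS x with hy
  set r := servingDist x with hrdef
  set a := t * P₁ / P₀ with ha
  have ha0 : 0 < a := by positivity
  set c : ℕ → ℝ := fun n => if n = y then 0 else a * (‖x n‖ / r) ^ (-α) with hc
  have hc0 : ∀ n, 0 ≤ c n := fun n => by simp only [hc]; split_ifs <;> positivity
  have hcs : Summable c := Summable.of_nonneg_of_le hc0
    (fun n => by simp only [hc]; split_ifs; positivity; exact le_rfl)
    ((hx.summable_div hα hr).mul_left a)
  have hcy : c y = 0 := by simp [hc]
  set K := t * N / P₀ * r ^ α with hK
  have hK0 : 0 ≤ K := by positivity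
  have hexp : μ * K + ∑' n, Real.log (1 + c n) = coverageExponent α (μ * (t * N / P₀)) a x := by
    rw [coverageExponent, ← hrdef, ← hy, hK, ← mul_assoc]
    congr 1
    refine tsum_congr fun n => ?_
    simp only [hc, fadingLoss]
    split_ifs <;> simp
  have hkey : ∀ᵐ ω ∂Pr, ∃ D : ℝ, 0 < D ∧ K + ∑' n, c n * g n ω = t * D * (r ^ α / P₀) ∧
      sinr α N P₀ P₁ x (fun n => g n ω) = g y ω / (r ^ α / P₀) / D := by
    filter_upwards [ae_nonneg_of_hasLaw_exp hμ hg, ae_ne_zero_of_hasLaw_exp hg,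
      hx.ae_summable_interferenceTerm hα hμ hg] with ω h0 h0' hs
    have hterm : ∀ n, 0 ≤ interferenceTerm α x (fun n => g n ω) n := fun n => by
      unfold interferenceTerm
      split_ifs
      · exact le_rfl
      · exact mul_nonneg (h0 n) (by positivity)
    -- The noise may vanish, so positivity of the denominator must come from the interference. The
    -- index y + 1 is a station other than the serving one.
    have hI : 0 < interference α x fun n => g n ω := by
      refine hs.tsum_pos hterm (y + 1) ?_
      rw [interferenceTerm, if_neg (by omega)]
      exact mul_pos (lt_of_le_of_ne (h0 _) (h0' _).symm)
        (Real.rpow_pos_of_pos (norm_pos_iff.2 (hx.ne_zero _)) _)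
    refine ⟨N + P₁ * interference α x fun n => g n ω, by positivity, ?_, ?_⟩
    · have h1 : ∑' n, c n * g n ω = a * r ^ α * interference α x fun n => g n ω := by
        rw [interference, ← tsum_mul_left]
        refine tsum_congr fun n => ?_
        simp only [hc, interferenceTerm]
        split_ifs
        · simp
        · rw [Real.div_rpow (norm_nonneg _) hr.le, Real.rpow_neg hr.le]
          field_simp
      rw [h1, hK, ha]
      field_simp
    · rw [sinr, ← hy]
      change P₀ * g y ω * r ^ (-α) / _ = _
      rw [Real.rpow_neg hr.le]
      field_simp
  rw [← hexp, ← measure_fading_le hμ hgm hg hind hc0 hcs hK0 hcy]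
  refine ⟨?_, (measure_congr ?_).trans ((measure_fading_lt hμ hgm hg hind hc0 hcs hK0 hcy).trans
    (measure_fading_le hμ hgm hg hind hc0 hcs hK0 hcy).symm)⟩
  · refine measure_congr ?_
    filter_upwards [hkey] with ω ⟨D, hD, h1, h2⟩
    refine propext ?_
    change t ≤ sinr α N P₀ P₁ x (fun n => g n ω) ↔ K + ∑' n, c n * g n ω ≤ g y ω
    rw [h1, h2, le_div_iff₀ hD, le_div_iff₀ (by positivity)]
  · filter_upwards [hkey] with ω ⟨D, hD, h1, h2⟩
    refine propext ?_
    change t < sinr α N P₀ P₁ x (fun n => g n ω) ↔ K + ∑' n, c n * g n ω < g y ω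
    rw [h1, h2, lt_div_iff₀ hD, lt_div_iff₀ (by positivity)]

end Sinr

/-! ### Evaluation of the radial integrals -/

section Coverage

variable {α : ℝ}

lemma exp_neg_fadingLoss {a u : ℝ} (ha : 0 ≤ a) (hu : 0 < u) :
    Real.exp (-fadingLoss α a u) = 1 / (1 + a * u ^ (-α)) := by
  have : 0 ≤ a * u ^ (-α) := by positivity
  rw [fadingLoss, Real.exp_neg, Real.exp_log (by linarith), one_div]

/-- Substitute u = t^{-2/α} x², under which 1/(1 + u^{α/2}) becomes 1/(1 + x^α/t) = 1 - 1/(1 + t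
x^{-α}). -/
lemma rho_eq_outerIntegral (hα : 0 < α) {t : ℝ} (ht : 0 < t) :
    rho t α = 2 * outerIntegral (fadingLoss α t) := by
  set s : ℝ := t ^ (-(2 / α)) with hs
  have hs0 : 0 < s := by positivity
  set h : ℝ → ℝ := fun u => 1 / (1 + u ^ (α / 2)) with hh
  have h1 := integral_comp_mul_left_Ioi h 1 hs0
  -- The squaring substitution runs over (0, ∞), hence the cut-off at 1 by an indicator.
  have h2 := integral_comp_rpow_Ioi ((Ioi 1).indicator fun x => h (s * x)) (p := 2) two_ne_zero
  rw [setIntegral_indicator measurableSet_Ioi,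
    inter_eq_self_of_subset_right (Ioi_subset_Ioi zero_le_one), h1, mul_one] at h2
  have h3 : rho t α = s⁻¹ • ∫ x in Ioi s, h x := by
    rw [rho, smul_eq_mul, hs, Real.rpow_neg ht.le, inv_inv]
  rw [h3, ← h2, outerIntegral, ← integral_const_mul, ← integral_indicator measurableSet_Ioi,
    ← integral_indicator measurableSet_Ioi]
  refine integral_congr_ae (Eventually.of_forall fun u => ?_)
  by_cases hu : 1 < u
  · have hu0 : 0 < u := one_pos.trans hu
    have h4 : (1 : ℝ) < u ^ (2 : ℝ) := Real.one_lt_rpow hu two_pos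
    simp only [indicator_of_mem (show u ∈ Ioi (0 : ℝ) from hu0),
      indicator_of_mem (show u ∈ Ioi (1 : ℝ) from hu),
      indicator_of_mem (show u ^ (2 : ℝ) ∈ Ioi (1 : ℝ) from h4), smul_eq_mul]
    rw [exp_neg_fadingLoss ht.le hu0, hh]
    have h5 : (s * u ^ (2 : ℝ)) ^ (α / 2) = t⁻¹ * u ^ α := by
      rw [Real.mul_rpow hs0.le (by positivity), hs, ← Real.rpow_mul ht.le, ← Real.rpow_mul hu0.le]
      have e1 : -(2 / α) * (α / 2) = -1 := by field_simp
      have e2 : 2 * (α / 2) = α := by ring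
      rw [e1, e2, Real.rpow_neg_one]
    simp only [h5]
    have hua : 0 < u ^ α := by positivity
    rw [Real.rpow_neg hu0.le, show (2 : ℝ) - 1 = 1 by norm_num, Real.rpow_one, abs_two]
    field_simp
    ring
  · rw [indicator_of_notMem (show u ∉ Ioi (1 : ℝ) from hu)]
    by_cases hu0 : 0 < u
    · have h4 : ¬ (1 : ℝ) < u ^ (2 : ℝ) := not_lt.2
        (Real.rpow_le_one hu0.le (not_lt.1 hu) two_pos.le)
      rw [indicator_of_mem (show u ∈ Ioi (0 : ℝ) from hu0),
        indicator_of_notMem (show u ^ (2 : ℝ) ∉ Ioi (1 : ℝ) from h4), smul_zero]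
    · rw [indicator_of_notMem (show u ∉ Ioi (0 : ℝ) from hu0)]

lemma IsPathLoss.add {C D : ℝ} {F G : ℝ → ℝ} (hF : IsPathLoss α C F) (hG : IsPathLoss α D G) :
    IsPathLoss α (C + D) fun u => F u + G u where
  measurable := hF.measurable.add hG.measurable
  nonneg u hu := add_nonneg (hF.nonneg u hu) (hG.nonneg u hu)
  continuousOn := hF.continuousOn.add hG.continuousOn
  le u hu := by rw [add_mul]; exact add_le_add (hF.le u hu) (hG.le u hu)

/-- The two factors multiply to e^{-(F + G)}, so ξ is the outer integral of the sum of both losses.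
-/
lemma xiIntegrand_eq {T TFR η β u : ℝ} (h1 : 0 ≤ η * TFR) (h2 : 0 ≤ η * T / β) (hu : 0 < u) :
    xiIntegrand T TFR α η β u =
      (1 - Real.exp (-(fadingLoss α (η * TFR) u + fadingLoss α (η * T / β) u))) * u := by
  rw [neg_add, Real.exp_add, exp_neg_fadingLoss h1 hu, exp_neg_fadingLoss h2 hu, xiIntegrand]

lemma integrableOn_exp_coverage {A k : ℝ} (hA : 0 < A) (hk : 0 ≤ k) :
    IntegrableOn (fun v : ℝ => Real.exp (-A * v - k * v ^ (α / 2))) (Ioi 0) := by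
  refine (exp_neg_integrableOn_Ioi 0 hA).mono' (by fun_prop) ?_
  refine (ae_restrict_iff' measurableSet_Ioi).2 (Eventually.of_forall fun v hv => ?_)
  have hv0 : (0 : ℝ) < v := hv
  rw [Real.norm_of_nonneg (Real.exp_pos _).le]
  refine Real.exp_le_exp.2 ?_
  have : 0 ≤ k * v ^ (α / 2) := by positivity
  linarith

variable {Ω : Type*} [MeasurableSpace Ω] {Pr : Measure Ω} [IsProbabilityMeasure Pr] {lam : ℝ}
  {X : ℕ → Ω → Plane} {C : ℝ} {F : ℝ → ℝ}

/-- The expectation of `exp (-k r^α - ∑_{z ≠ y} F (R_z / r))` as an integral over the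
squared distance `v = r²`. -/
lemma IsHomogeneousPPP.lintegral_coverage (hlam : 0 < lam) (hX : IsHomogeneousPPP Pr lam X)
    (hα : 2 < α) (hF : IsPathLoss α C F) {k : ℝ} (hk : 0 ≤ k) :
    ∫⁻ ω, expNeg (ENNReal.ofReal (k * (servingDist fun n => X n ω) ^ α +
        ∑' n, if n = servingBS (fun n => X n ω) then 0 else
          F (‖X n ω‖ / servingDist fun n => X n ω))) ∂Pr =
      ENNReal.ofReal (Real.pi * lam * ∫ v in Ioi (0 : ℝ),
        Real.exp (-(Real.pi * lam * (1 + 2 * outerIntegral F)) * v - k * v ^ (α / 2))) := by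
  have hJ := hF.outerIntegral_nonneg
  have h1 : ∀ᵐ ω ∂Pr, expNeg (ENNReal.ofReal (k * (servingDist fun n => X n ω) ^ α +
        ∑' n, if n = servingBS (fun n => X n ω) then 0 else
          F (‖X n ω‖ / servingDist fun n => X n ω))) =
      expNeg (ENNReal.ofReal (k * (servingDist fun n => X n ω) ^ α)) *
        expNeg (ENNReal.ofReal (∑' n, if n = servingBS (fun n => X n ω) then 0 else
          F (‖X n ω‖ / servingDist fun n => X n ω))) := by
    filter_upwards [hX.ae_isRegularConfig hlam.le hα] with ω hω
    have hr := hω.servingDist_pos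
    rw [← expNeg_add, ENNReal.ofReal_add (by positivity)]
    refine tsum_nonneg fun n => ?_
    split_ifs
    · exact le_rfl
    · exact hF.nonneg _ (div_pos (norm_pos_iff.2 (hω.ne_zero n)) hr)
  have hκ : Continuous fun r : ℝ => expNeg (ENNReal.ofReal (k * r ^ α)) :=
    continuous_expNeg.comp (ENNReal.continuous_ofReal.comp
      (continuous_const.mul (Real.continuous_rpow_const (by linarith))))
  have hGm : Measurable fun r : ℝ => expNeg (ENNReal.ofReal (k * r ^ α)) *
      expNeg (ENNReal.ofReal lam * ENNReal.ofReal (2 * Real.pi * r ^ 2 * outerIntegral F)) :=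
    hκ.measurable.mul (measurable_expNeg.comp (by fun_prop))
  have hA : 0 < Real.pi * lam * (1 + 2 * outerIntegral F) := by positivity
  rw [lintegral_congr_ae h1,
    hX.lintegral_exp_pathLoss hlam.le hα hF hκ (fun r => expNeg_le_one _),
    hX.lintegral_servingDist hlam hGm, ← integral_const_mul,
    ofReal_integral_eq_lintegral_ofReal ((integrableOn_exp_coverage hA hk).const_mul _)
      (Eventually.of_forall fun v => by positivity)]
  refine setLIntegral_congr_fun measurableSet_Ioi fun v hv => ?_
  have hv0 : (0 : ℝ) < v := hv
  have hsq : √v ^ α = v ^ (α / 2) := by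
    rw [Real.sqrt_eq_rpow, ← Real.rpow_mul hv0.le]
    congr 1; ring
  simp only [hsq, Real.sq_sqrt hv0.le]
  rw [← ENNReal.ofReal_mul hlam.le, expNeg_ofReal (by positivity), expNeg_ofReal (by positivity),
    ← ENNReal.ofReal_mul (Real.exp_pos _).le, ← ENNReal.ofReal_mul (by positivity),
    ← Real.exp_add, mul_assoc, ← Real.exp_add]
  congr 3
  ring

end Coverage

/-! ### Measurability of the SINR and freezing of independent variables -/

section Independence

lemma measurable_interferenceTerm (α : ℝ) (n : ℕ) :
    Measurable fun p : (ℕ → Plane) × (ℕ → ℝ) => interferenceTerm α p.1 p.2 n := by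
  refine Measurable.ite ?_ measurable_const (by fun_prop)
  exact (measurable_servingBS.comp measurable_fst) (measurableSet_singleton n) |>.congr
    (by ext p; simp [eq_comm])

lemma measurable_sinr (α N P₀ P₁ : ℝ) :
    Measurable fun p : (ℕ → Plane) × (ℕ → ℝ) => sinr α N P₀ P₁ p.1 p.2 := by
  have h1 : Measurable fun p : (ℕ → Plane) × (ℕ → ℝ) => servingDist p.1 :=
    measurable_servingDist.comp measurable_fst
  have h3 : Measurable fun p : (ℕ → Plane) × (ℕ → ℝ) => interference α p.1 p.2 :=
    Measurable.tsum (measurable_interferenceTerm α)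
  exact ((measurable_apply_servingBS.const_mul P₀).mul (h1.pow_const (-α))).div
    (measurable_const.add (h3.const_mul P₁))

variable {Ω : Type*} [MeasurableSpace Ω] {Pr : Measure Ω} [IsProbabilityMeasure Pr]

/-- For independent `U` and `V`, the value of `U` may be frozen. -/
lemma measure_eq_lintegral_of_indepFun {E E' : Type*} [MeasurableSpace E] [MeasurableSpace E']
    {U : Ω → E} {V : Ω → E'} (hU : Measurable U) (hV : Measurable V) (h : IndepFun U V Pr)
    {S : Set (E × E')} (hS : MeasurableSet S) :
    Pr {ω | (U ω, V ω) ∈ S} = ∫⁻ ω, Pr {ω' | (U ω, V ω') ∈ S} ∂Pr := by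
  have h1 := h.map_prod_eq_prod_map_map hU.aemeasurable hV.aemeasurable
  have h2 : Pr {ω | (U ω, V ω) ∈ S} = Pr.map (fun ω => (U ω, V ω)) S := by
    rw [Measure.map_apply (hU.prodMk hV) hS]; rfl
  rw [h2, h1, Measure.prod_apply hS, lintegral_map (measurable_measure_prodMk_left hS) hU]
  refine lintegral_congr fun ω => ?_
  rw [Measure.map_apply hV (measurable_prodMk_left hS)]
  rfl

omit [IsProbabilityMeasure Pr] in
lemma indepFun_families {g g' : ℕ → Ω → ℝ} (hg : ∀ n, Measurable (g n))
    (hg' : ∀ n, Measurable (g' n)) (h : iIndepFun (Sum.elim g g') Pr) :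
    IndepFun (fun ω n => g n ω) (fun ω n => g' n ω) Pr := by
  have hm : ∀ k, Measurable (Sum.elim g g' k) := by rintro (n | n); exacts [hg n, hg' n]
  have hd : Disjoint (range (Sum.inl : ℕ → ℕ ⊕ ℕ)) (range (Sum.inr : ℕ → ℕ ⊕ ℕ)) := by
    rw [Set.disjoint_left]
    rintro _ ⟨a, rfl⟩ ⟨b, hb⟩
    simp at hb
  have h1 := indep_iSup_of_disjoint (fun k => (hm k).comap_le) h.iIndep hd
  rw [IndepFun_iff_Indep]
  refine indep_of_indep_of_le_left (indep_of_indep_of_le_right h1 ?_) ?_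
  · refine Measurable.comap_le ?_
    refine @measurable_pi_lambda _ _ _ (_) _ _ fun n => ?_
    refine Measurable.mono (comap_measurable (Sum.elim g g' (Sum.inr n))) ?_ le_rfl
    exact le_iSup₂_of_le (Sum.inr n) ⟨n, rfl⟩ le_rfl
  · refine Measurable.comap_le ?_
    refine @measurable_pi_lambda _ _ _ (_) _ _ fun n => ?_
    refine Measurable.mono (comap_measurable (Sum.elim g g' (Sum.inl n))) ?_ le_rfl
    exact le_iSup₂_of_le (Sum.inl n) ⟨n, rfl⟩ le_rfl

end Independence

/-! ### Averaging the SINR events over the base stations -/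

section CoverageProbability

variable {Ω : Type*} [MeasurableSpace Ω] {Pr : Measure Ω} [IsProbabilityMeasure Pr]
  {lam α μ : ℝ} {X : ℕ → Ω → Plane} {g g' : ℕ → Ω → ℝ}

lemma IsHomogeneousPPP.measure_sinr (hlam : 0 < lam) (hX : IsHomogeneousPPP Pr lam X)
    (hα : 2 < α) (hμ : 0 < μ) (hgm : ∀ n, Measurable (g n))
    (hg : ∀ n, HasLaw (g n) (expMeasure μ) Pr) (hind : iIndepFun g Pr)
    (hXg : IndepFun (fun ω n => X n ω) (fun ω n => g n ω) Pr) {t N P₀ P₁ : ℝ} (ht : 0 < t)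
    (hN : 0 ≤ N) (hP₀ : 0 < P₀) (hP₁ : 0 < P₁) :
    Pr {ω | t ≤ sinr α N P₀ P₁ (fun n => X n ω) fun n => g n ω} =
        ∫⁻ ω, expNeg (ENNReal.ofReal (coverageExponent α (μ * (t * N / P₀)) (t * P₁ / P₀)
          fun n => X n ω)) ∂Pr ∧
      Pr {ω | t < sinr α N P₀ P₁ (fun n => X n ω) fun n => g n ω} =
        ∫⁻ ω, expNeg (ENNReal.ofReal (coverageExponent α (μ * (t * N / P₀)) (t * P₁ / P₀)
          fun n => X n ω)) ∂Pr := by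
  have hV : Measurable fun ω n => g n ω := measurable_pi_lambda _ hgm
  have h1 := measure_eq_lintegral_of_indepFun hX.measurable_config hV hXg
    (measurableSet_le measurable_const (measurable_sinr α N P₀ P₁) :
      MeasurableSet {p : (ℕ → Plane) × (ℕ → ℝ) | t ≤ sinr α N P₀ P₁ p.1 p.2})
  have h2 := measure_eq_lintegral_of_indepFun hX.measurable_config hV hXg
    (measurableSet_lt measurable_const (measurable_sinr α N P₀ P₁) :
      MeasurableSet {p : (ℕ → Plane) × (ℕ → ℝ) | t < sinr α N P₀ P₁ p.1 p.2})
  refine ⟨h1.trans (lintegral_congr_ae ?_), h2.trans (lintegral_congr_ae ?_)⟩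
  · filter_upwards [hX.ae_isRegularConfig hlam.le hα] with ω hω
    exact (hω.measure_sinr (by linarith) hμ hgm hg hind ht hN hP₀ hP₁).1
  · filter_upwards [hX.ae_isRegularConfig hlam.le hα] with ω hω
    exact (hω.measure_sinr (by linarith) hμ hgm hg hind ht hN hP₀ hP₁).2

lemma IsHomogeneousPPP.ae_summable_interferenceTerm (hlam : 0 < lam)
    (hX : IsHomogeneousPPP Pr lam X) (hα : 2 < α) (hμ : 0 < μ) (hgm : ∀ n, Measurable (g n))
    (hg : ∀ n, HasLaw (g n) (expMeasure μ) Pr)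
    (hXg : IndepFun (fun ω n => X n ω) (fun ω n => g n ω) Pr) :
    ∀ᵐ ω ∂Pr, Summable (interferenceTerm α (fun n => X n ω) fun n => g n ω) := by
  have hV : Measurable fun ω n => g n ω := measurable_pi_lambda _ hgm
  -- Summability as finiteness of a sum in [0, ∞] is a measurable event, so the stations can be
  -- frozen.
  have hiff : ∀ u : ℕ → ℝ, Summable u ↔ ∑' n, ‖u n‖ₑ ≠ ⊤ := by
    refine fun u => ⟨fun h => ?_, fun h => ?_⟩
    · simp_rw [← ofReal_norm]
      rw [← ENNReal.ofReal_tsum_of_nonneg (fun n => norm_nonneg _) h.norm]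
      exact ENNReal.ofReal_ne_top
    · exact Summable.of_norm ((ENNReal.summable_toReal h).congr fun n => toReal_enorm _)
  have hS : MeasurableSet
      {p : (ℕ → Plane) × (ℕ → ℝ) | ∑' n, ‖interferenceTerm α p.1 p.2 n‖ₑ = ⊤} :=
    (Measurable.tsum fun n => (measurable_interferenceTerm α n).enorm) (measurableSet_singleton ⊤)
  have h1 := measure_eq_lintegral_of_indepFun hX.measurable_config hV hXg hS
  have h2 : ∀ᵐ ω ∂Pr, Pr {ω' | ((fun n => X n ω), fun n => g n ω') ∈
      {p : (ℕ → Plane) × (ℕ → ℝ) | ∑' n, ‖interferenceTerm α p.1 p.2 n‖ₑ = ⊤}} = 0 := by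
    filter_upwards [hX.ae_isRegularConfig hlam.le hα] with ω hω
    have h3 := hω.ae_summable_interferenceTerm (by linarith) hμ hg
    simp_rw [hiff, ae_iff, not_not] at h3
    exact h3
  rw [lintegral_congr_ae h2, lintegral_zero] at h1
  simp_rw [hiff, ae_iff, not_not]
  exact h1

/-- Once the stations are frozen, the two events depend on the independent families g and g', so
their probabilities multiply. -/
lemma IsHomogeneousPPP.measure_sinr_inter (hlam : 0 < lam) (hX : IsHomogeneousPPP Pr lam X)
    (hα : 2 < α) (hμ : 0 < μ) (hgm : ∀ n, Measurable (g n)) (hgm' : ∀ n, Measurable (g' n))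
    (hg : ∀ n, HasLaw (g n) (expMeasure μ) Pr) (hg' : ∀ n, HasLaw (g' n) (expMeasure μ) Pr)
    (hfading : iIndepFun (Sum.elim g g') Pr)
    (hindep : IndepFun (fun (ω : Ω) (n : ℕ) => X n ω)
      (fun (ω : Ω) (k : ℕ ⊕ ℕ) => Sum.elim g g' k ω) Pr)
    {t t' N P₀ P₀' P₁ : ℝ} (ht : 0 < t) (ht' : 0 < t')
    (hN : 0 ≤ N) (hP₀ : 0 < P₀) (hP₀' : 0 < P₀') (hP₁ : 0 < P₁) :
    Pr {ω | t ≤ sinr α N P₀ P₁ (fun n => X n ω) (fun n => g n ω) ∧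
        t' < sinr α N P₀' P₁ (fun n => X n ω) fun n => g' n ω} =
      ∫⁻ ω, expNeg (ENNReal.ofReal (coverageExponent α (μ * (t * N / P₀)) (t * P₁ / P₀)
          fun n => X n ω)) *
        expNeg (ENNReal.ofReal (coverageExponent α (μ * (t' * N / P₀')) (t' * P₁ / P₀')
          fun n => X n ω)) ∂Pr := by
  have hV : Measurable fun (ω : Ω) (k : ℕ ⊕ ℕ) => Sum.elim g g' k ω :=
    measurable_pi_lambda _ (by rintro (n | n); exacts [hgm n, hgm' n])
  have hproj : ∀ e : ℕ → ℕ ⊕ ℕ, Measurable fun p : (ℕ → Plane) × (ℕ ⊕ ℕ → ℝ) =>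
      (p.1, fun n => p.2 (e n)) := fun e => by fun_prop
  have hS : MeasurableSet {p : (ℕ → Plane) × (ℕ ⊕ ℕ → ℝ) |
      t ≤ sinr α N P₀ P₁ p.1 (fun n => p.2 (Sum.inl n)) ∧
        t' < sinr α N P₀' P₁ p.1 (fun n => p.2 (Sum.inr n))} :=
    (measurableSet_le measurable_const ((measurable_sinr α N P₀ P₁).comp (hproj Sum.inl))).inter
      (measurableSet_lt measurable_const ((measurable_sinr α N P₀' P₁).comp (hproj Sum.inr)))
  refine (measure_eq_lintegral_of_indepFun hX.measurable_config hV hindep hS).trans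
    (lintegral_congr_ae ?_)
  have hind : iIndepFun g Pr := hfading.precomp (g := Sum.inl) Sum.inl_injective
  have hind' : iIndepFun g' Pr := hfading.precomp (g := Sum.inr) Sum.inr_injective
  filter_upwards [hX.ae_isRegularConfig hlam.le hα] with ω hω
  rw [← (hω.measure_sinr (by linarith) hμ hgm hg hind ht hN hP₀
      hP₁).1,
    ← (hω.measure_sinr (by linarith) hμ hgm' hg' hind' ht' hN hP₀'
      hP₁).2]
  have hs : ∀ P : ℝ, Measurable fun h : ℕ → ℝ => sinr α N P P₁ (fun n => X n ω) h := fun P =>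
    (measurable_sinr α N P P₁).comp (measurable_const.prodMk measurable_id)
  exact (indepFun_families hgm hgm' hfading).measure_inter_preimage_eq_mul
    {h : ℕ → ℝ | t ≤ sinr α N P₀ P₁ (fun n => X n ω) h}
    {h : ℕ → ℝ | t' < sinr α N P₀' P₁ (fun n => X n ω) h}
    (measurableSet_le measurable_const (hs P₀)) (measurableSet_lt measurable_const (hs P₀'))

lemma IsRegularConfig.summable_pathLoss {x : ℕ → Plane} {C : ℝ} {F : ℝ → ℝ} (hα : 0 < α)
    (hx : IsRegularConfig α x) (hF : IsPathLoss α C F) :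
    Summable fun n => if n = servingBS x then 0 else F (‖x n‖ / servingDist x) := by
  have hr := hx.servingDist_pos
  have hpos : ∀ n, 0 < ‖x n‖ / servingDist x :=
    fun n => div_pos (norm_pos_iff.2 (hx.ne_zero n)) hr
  refine Summable.of_nonneg_of_le (fun n => ?_) (fun n => ?_) ((hx.summable_div hα hr).mul_left C)
  · split_ifs
    exacts [le_rfl, hF.nonneg _ (hpos n)]
  · split_ifs
    exacts [(hF.nonneg _ (hpos n)).trans (hF.le _ (hpos n)), hF.le _ (hpos n)]

/-- A single interferer contributes a positive logarithm, even without noise. This is what makes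
edge users have positive probability. -/
lemma IsRegularConfig.coverageExponent_pos {x : ℕ → Plane} (hα : 0 < α)
    (hx : IsRegularConfig α x) {k a : ℝ} (hk : 0 ≤ k) (ha : 0 < a) :
    0 < coverageExponent α k a x := by
  have hr := hx.servingDist_pos
  have hpos : ∀ n, 0 < ‖x n‖ / servingDist x :=
    fun n => div_pos (norm_pos_iff.2 (hx.ne_zero n)) hr
  have hF := isPathLoss_fadingLoss (α := α) ha.le
  refine add_pos_of_nonneg_of_pos (by positivity)
    ((hx.summable_pathLoss hα hF).tsum_pos (fun n => ?_) (servingBS x + 1) ?_)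
  · split_ifs
    exacts [le_rfl, hF.nonneg _ (hpos n)]
  · rw [if_neg (by omega)]
    have := hpos (servingBS x + 1)
    have : 0 < a * (‖x (servingBS x + 1)‖ / servingDist x) ^ (-α) := by positivity
    exact Real.log_pos (by linarith)

lemma IsRegularConfig.coverageExponent_add {x : ℕ → Plane} (hα : 0 < α)
    (hx : IsRegularConfig α x) {k a k' a' : ℝ} (ha : 0 ≤ a) (ha' : 0 ≤ a') :
    coverageExponent α k a x + coverageExponent α k' a' x =
      (k + k') * servingDist x ^ α + ∑' n, if n = servingBS x then 0 else
        (fadingLoss α a (‖x n‖ / servingDist x) + fadingLoss α a' (‖x n‖ / servingDist x)) := by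
  have h1 : ∀ n, (if n = servingBS x then 0 else
      (fadingLoss α a (‖x n‖ / servingDist x) + fadingLoss α a' (‖x n‖ / servingDist x))) =
      (if n = servingBS x then 0 else fadingLoss α a (‖x n‖ / servingDist x)) +
      (if n = servingBS x then 0 else fadingLoss α a' (‖x n‖ / servingDist x)) := fun n => by
    split_ifs <;> simp
  simp_rw [h1]
  rw [(hx.summable_pathLoss hα (isPathLoss_fadingLoss ha)).tsum_add
    (hx.summable_pathLoss hα (isPathLoss_fadingLoss ha')), coverageExponent, coverageExponent]
  ring

end CoverageProbability

/-! ### The coverage probability of an edge user -/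

theorem theorem3 {Ω : Type*} [MeasurableSpace Ω] (Pr : Measure Ω) [IsProbabilityMeasure Pr]
    (lam α μ σ P β T TFR : ℝ) (Δ : ℕ)
    (hlam : 0 < lam) (hα : 2 < α) (hμ : 0 < μ) (hP : 0 < P) (hβ : 1 ≤ β)
    (hT : 0 < T) (hTFR : 0 < TFR) (hΔ : 1 ≤ Δ)
    -- the base stations, and the fading on the initial sub-band and on the new sub-band
    (X : ℕ → Ω → Plane) (g g' : ℕ → Ω → ℝ)
    (hX : IsHomogeneousPPP Pr lam X)
    (hg : ∀ n, Measurable (g n)) (hg' : ∀ n, Measurable (g' n))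
    (hglaw : ∀ n, HasLaw (g n) (expMeasure μ) Pr)
    (hglaw' : ∀ n, HasLaw (g' n) (expMeasure μ) Pr)
    (hfading : iIndepFun (Sum.elim g g') Pr)
    (hindep : IndepFun (fun (ω : Ω) (n : ℕ) => X n ω)
      (fun (ω : Ω) (k : ℕ ⊕ ℕ) => Sum.elim g g' k ω) Pr)
    (η : ℝ) (hη : η = etaSFR Δ β)
    -- the initial SINR, and the SINR after the user was moved to an edge sub-band
    (initial final : Ω → ℝ)
    (hinitial : initial = fun ω =>
      sinr α (σ ^ 2) P (η * P) (fun n => X n ω) (fun n => g n ω))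
    (hfinal : final = fun ω =>
      sinr α (σ ^ 2) (β * P) (η * P) (fun n => X n ω) (fun n => g' n ω)) :
    -- the quantities involved are well defined
    (∀ᵐ ω ∂Pr, IsNearest (fun n => X n ω) (servingBS (fun n => X n ω)) ∧
      Summable (interferenceTerm α (fun n => X n ω) (fun n => g n ω)) ∧
      Summable (interferenceTerm α (fun n => X n ω) (fun n => g' n ω))) ∧
    IntegrableOn (xiIntegrand T TFR α η β) (Ioi 1) ∧
    IntegrableOn (jointIntegrand μ (σ ^ 2) P T TFR lam α η β) (Ioi 0) ∧
    0 < Pr.real {ω | initial ω < TFR} ∧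
    -- the coverage probability of an edge user
    (cond Pr {ω | initial ω < TFR}).real {ω | T < final ω} =
      (pc μ (σ ^ 2 / η) P (η * T / β) lam α 1
          - Real.pi * lam * ∫ v in Ioi (0 : ℝ), jointIntegrand μ (σ ^ 2) P T TFR lam α η β v)
        / (1 - pc μ (σ ^ 2 / η) P (η * TFR) lam α 1) := by
  have hα0 : 0 < α := by linarith
  have hβ0 : 0 < β := by linarith
  have hη0 : 0 < η := by
    have h1 : (1 : ℝ) ≤ Δ := by exact_mod_cast hΔ
    rw [hη, etaSFR]
    exact div_pos (by linarith) (by linarith)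
  have hσ : 0 ≤ σ ^ 2 := sq_nonneg σ
  have hXm := hX.measurable_config
  have hindg : iIndepFun g Pr := hfading.precomp (g := Sum.inl) Sum.inl_injective
  have hindg' : iIndepFun g' Pr := hfading.precomp (g := Sum.inr) Sum.inr_injective
  have hXg : IndepFun (fun ω n => X n ω) (fun ω n => g n ω) Pr :=
    hindep.comp measurable_id (ψ := fun (h : ℕ ⊕ ℕ → ℝ) n => h (Sum.inl n)) (by fun_prop)
  have hXg' : IndepFun (fun ω n => X n ω) (fun ω n => g' n ω) Pr :=
    hindep.comp measurable_id (ψ := fun (h : ℕ ⊕ ℕ → ℝ) n => h (Sum.inr n)) (by fun_prop)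
  have hreg := hX.ae_isRegularConfig hlam.le hα
  have hgm : Measurable fun ω n => g n ω := measurable_pi_lambda _ hg
  have hgm' : Measurable fun ω n => g' n ω := measurable_pi_lambda _ hg'
  have ha : 0 < η * TFR := by positivity
  have ha' : 0 < η * T / β := by positivity
  have hF := isPathLoss_fadingLoss (α := α) ha.le
  have hF' := isPathLoss_fadingLoss (α := α) ha'.le
  have hFF := hF.add hF'
  have hxi : xiSFR T TFR α η β = outerIntegral fun u =>
      fadingLoss α (η * TFR) u + fadingLoss α (η * T / β) u :=
    setIntegral_congr_fun measurableSet_Ioi fun u hu =>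
      xiIntegrand_eq ha.le ha'.le (one_pos.trans hu)
  have hxi0 : 0 ≤ xiSFR T TFR α η β := hxi ▸ hFF.outerIntegral_nonneg
  set k : ℝ := μ * (TFR * σ ^ 2 / P) with hk
  set k' : ℝ := μ * (T * σ ^ 2 / (β * P)) with hk'
  have hk0 : 0 ≤ k := by positivity
  have hk0' : 0 ≤ k' := by positivity
  have hjoint : jointIntegrand μ (σ ^ 2) P T TFR lam α η β = fun v => Real.exp
      (-(Real.pi * lam * (1 + 2 * xiSFR T TFR α η β)) * v - (k + k') * v ^ (α / 2)) := by
    funext v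
    rw [jointIntegrand, hk, hk']
    congr 1
    field_simp
    ring
  have hjA : 0 < Real.pi * lam * (1 + 2 * xiSFR T TFR α η β) := by positivity
  -- The noise σ²/η in `pc` offsets the factor η in its threshold: for t = η T_FR and t = η T/β the
  -- constant k₀ is k and k', free of η.
  have hpc : ∀ {t k₀ : ℝ}, 0 < t → k₀ = μ * t * (σ ^ 2 / η / P) →
      pc μ (σ ^ 2 / η) P t lam α 1 = Real.pi * lam * ∫ v in Ioi (0 : ℝ), Real.exp
        (-(Real.pi * lam * (1 + 2 * outerIntegral (fadingLoss α t))) * v - k₀ * v ^ (α / 2)) := by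
    intro t k₀ ht h
    rw [pc, rho_eq_outerIntegral hα0 ht, h]
    congr 2
    funext v
    congr 1
    ring
  have hpc0 : ∀ t, 0 ≤ pc μ (σ ^ 2 / η) P t lam α 1 := fun t =>
    mul_nonneg (by positivity) (integral_nonneg fun v => (Real.exp_pos _).le)
  set A : Set Ω := {ω | TFR ≤ initial ω} with hA
  set B : Set Ω := {ω | T < final ω} with hB
  have hinim : Measurable initial := hinitial ▸
    (measurable_sinr α (σ ^ 2) P (η * P)).comp (hXm.prodMk hgm)
  have hfinm : Measurable final := hfinal ▸
    (measurable_sinr α (σ ^ 2) (β * P) (η * P)).comp (hXm.prodMk hgm')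
  have hAm : MeasurableSet A := measurableSet_le measurable_const hinim
  have hBm : MeasurableSet B := measurableSet_lt measurable_const hfinm
  have hAc : {ω | initial ω < TFR} = Aᶜ := by ext ω; simp [hA]
  have e1 : TFR * (η * P) / P = η * TFR := by field_simp
  have e2 : T * (η * P) / (β * P) = η * T / β := by field_simp
  have hPA' : Pr A = ∫⁻ ω, expNeg (ENNReal.ofReal
      (coverageExponent α k (η * TFR) fun n => X n ω)) ∂Pr := by
    have h := (hX.measure_sinr hlam hα hμ hg hglaw hindg hXg hTFR hσ hP (mul_pos hη0 hP)).1
    rw [e1] at h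
    rw [hA, hinitial]
    exact h
  have hPA : Pr A = ENNReal.ofReal (pc μ (σ ^ 2 / η) P (η * TFR) lam α 1) := by
    rw [hPA', hpc ha (k₀ := k) (by rw [hk]; field_simp)]
    exact hX.lintegral_coverage hlam hα hF hk0
  have hPB : Pr B = ENNReal.ofReal (pc μ (σ ^ 2 / η) P (η * T / β) lam α 1) := by
    have h := (hX.measure_sinr hlam hα hμ hg' hglaw' hindg' hXg' hT hσ (mul_pos hβ0 hP)
      (mul_pos hη0 hP)).2
    rw [e2] at h
    rw [hpc ha' (k₀ := k') (by rw [hk']; field_simp), hB, hfinal]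
    exact h.trans (hX.lintegral_coverage hlam hα hF' hk0')
  have hPAB : Pr (A ∩ B) = ENNReal.ofReal (Real.pi * lam * ∫ v in Ioi (0 : ℝ),
      jointIntegrand μ (σ ^ 2) P T TFR lam α η β v) := by
    have h := hX.measure_sinr_inter hlam hα hμ hg hg' hglaw hglaw' hfading hindep hTFR hT hσ hP
      (mul_pos hβ0 hP) (mul_pos hη0 hP)
    rw [e1, e2] at h
    rw [hjoint, hxi, ← hX.lintegral_coverage hlam hα hFF (add_nonneg hk0 hk0'), hA, hB, hinitial,
      hfinal]
    refine h.trans (lintegral_congr_ae ?_)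
    filter_upwards [hreg] with ω hω
    rw [← expNeg_add, ← ENNReal.ofReal_add (hω.coverageExponent_pos hα0 hk0 ha).le
      (hω.coverageExponent_pos hα0 hk0' ha').le, hω.coverageExponent_add hα0 ha.le ha'.le]
  -- The conditional probability is almost surely below 1, hence so is its mean.
  have hA1 : Pr A < 1 := by
    rw [hPA']
    have h1 := lintegral_strict_mono (μ := Pr) (f := fun ω => expNeg (ENNReal.ofReal
      (coverageExponent α k (η * TFR) fun n => X n ω))) (g := fun _ => 1)
      (IsProbabilityMeasure.ne_zero Pr) aemeasurable_const
      (by rw [← hPA']; exact measure_ne_top _ _) ?_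
    · simpa using h1
    · filter_upwards [hreg] with ω hω
      have hpos := hω.coverageExponent_pos hα0 hk0 ha
      rw [expNeg_ofReal hpos.le, ENNReal.ofReal_lt_one]
      exact Real.exp_lt_one_iff.2 (by linarith)
  have hrA : Pr.real A = pc μ (σ ^ 2 / η) P (η * TFR) lam α 1 := by
    rw [Measure.real, hPA, ENNReal.toReal_ofReal (hpc0 _)]
  have hrB : Pr.real B = pc μ (σ ^ 2 / η) P (η * T / β) lam α 1 := by
    rw [Measure.real, hPB, ENNReal.toReal_ofReal (hpc0 _)]
  have hrAB : Pr.real (A ∩ B) = Real.pi * lam * ∫ v in Ioi (0 : ℝ),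
      jointIntegrand μ (σ ^ 2) P T TFR lam α η β v := by
    rw [Measure.real, hPAB, ENNReal.toReal_ofReal]
    exact mul_nonneg (by positivity) (integral_nonneg fun v => (Real.exp_pos _).le)
  have hrAc : Pr.real Aᶜ = 1 - pc μ (σ ^ 2 / η) P (η * TFR) lam α 1 := by
    rw [probReal_compl_eq_one_sub hAm, hrA]
  refine ⟨?_, ?_, ?_, ?_, ?_⟩
  · filter_upwards [hreg, hX.ae_summable_interferenceTerm hlam hα hμ hg hglaw hXg,
      hX.ae_summable_interferenceTerm hlam hα hμ hg' hglaw' hXg'] with ω h1 h2 h3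
    exact ⟨h1.isNearest_servingBS hα0, h2, h3⟩
  · exact (hFF.integrableOn hα).congr_fun
      (fun u hu => (xiIntegrand_eq ha.le ha'.le (one_pos.trans hu)).symm) measurableSet_Ioi
  · rw [hjoint]
    exact integrableOn_exp_coverage hjA (add_nonneg hk0 hk0')
  · rw [hAc, Measure.real, ENNReal.toReal_pos_iff]
    refine ⟨?_, measure_lt_top _ _⟩
    rw [prob_compl_eq_one_sub hAm]
    exact tsub_pos_of_lt hA1
  · rw [hAc, Measure.real, cond_apply hAm.compl, ENNReal.toReal_mul, ENNReal.toReal_inv,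
      ← Measure.real, ← Measure.real, hrAc, ← hrB, ← hrAB, inv_mul_eq_div]
    congr 1
    -- P(Aᶜ ∩ B) = P(B) - P(A ∩ B).
    have h1 := measureReal_inter_add_sdiff (μ := Pr) (s := B) hAm
    rw [inter_comm A B, ← h1, add_sub_cancel_left]
    congr 1
    ext ω
    simp [and_comm]
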